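/- Consider the two-node tandem Jackson network with Poisson arrival rate $\lambda>0$ and exponential service rates $\mu_1>0$ (first queue) and $\mu_2>0$ (second queue). The capacity of the first queue is $m$, where $1\le m\le\infty$; for finite $m$, arrivals that find the first queue full are rejected. Let $J_t$ (the phase) and $Y_t$ (the level) be the numbers of customers in the first and in the second queue, let $\rho_i=\lambda/\mu_i$, and let $P_k^K(i,j)$ be the probability that the continuous-time Markov chain $(Y_t,J_t)$, started in $(k,i)$, hits the set of levels $\{0,K\}$ for the first time in the state $(K,j)$. 1. Let $1\le m<\infty$ and assume the stability condition $\rho_2<\frac{1-\rho_1^{m+1}}{1-\rho_1^m}$ if $\rho_1\ne1$, and $\rho_2<1+\frac1m$ if $\rho_1=1$. Let $H_m$ be the $(m+1)\times(m+1)$ matrix that is the elementwise limit of the increasing sequence of matrices $P_k^{k+1}$ as $k\to\infty$, and let $h_m$ be its maximal eigenvalue, that is, an eigenvalue of $H_m$ such that every complex eigenvalue has modulus at most $h_m$. Then $h_m$ exists, $0<h_m<1$, and for all $0\le i\le m$ and $0\le j\le m-1$ $$\lim_{K\to\infty}\frac{\log P_1^K(i,j)}{K}=\log h_m .$$ 2.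 Let $m=\infty$ and assume $\lambda<\min\{\mu_1,\mu_2\}$. Then the function $\tau(z)=-\lambda-\mu_1-\mu_2(1-z)+2\sqrt{\lambda\mu_1/z}$ has a unique zero $\eta$ in $(0,1)$, and for all $i,j\ge0$: (a) if $\mu_1\le\mu_2$, then $\lim_{K\to\infty}\frac{\log P_1^K(i,j)}{K}=\log\eta$; (b) if $\mu_1>\mu_2$, then $\lim_{K\to\infty}\frac{\log P_1^K(i,j)}{K}=\log\rho_2$. Moreover, the chain $(Y_t,J_t)$ has a unique stationary distribution $\pi$, and $\lim_{K\to\infty}\frac1K\log\sum_{j\ge0}\pi_{Kj}=\log\rho_2$. If $\mu_1<\mu_2$, then $\eta\ne\rho_2$, so the hitting probabilities and the stationary distribution of the level have different decay rates. -/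

import Mathlib

open Filter Topology MeasureTheory ProbabilityTheory
open scoped NNReal ENNReal

noncomputable section

namespace Tandem

/-! ### Continuous-time Markov chains on a countable state space

A chain is given by its generator `Q` (off-diagonal entries = transition intensities) and is
realised by its jump chain together with independent exponential holding times. -/

section CTMC

variable {S : Type*}

/-- The intensity of the transition `x → y`, for `x ≠ y`. -/
def rate (Q : Matrix S S ℝ) (x y : S) : ℝ≥0∞ :=
  open Classical in if x = y then 0 else ENNReal.ofReal (Q x y)

/-- The total intensity out of `x`. -/
def exitRate (Q : Matrix S S ℝ) (x : S) : ℝ≥0∞ := ∑' y, rate Q x y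

/-- The distribution of the next state after `x`: state `y` has probability
`rate Q x y / exitRate Q x`. An absorbing state is never left (its holding time is infinite). -/
def jumpPMF (Q : Matrix S S ℝ) (x : S) : PMF S :=
  open Classical in
  if h : exitRate Q x ≠ 0 ∧ exitRate Q x ≠ ∞ then PMF.normalize (rate Q x) h.1 h.2
  else PMF.pure x

variable [Countable S] [MeasurableSpace S] [MeasurableSingletonClass S]

/-- The transition kernel of the jump chain. -/
def jumpKernel (Q : Matrix S S ℝ) : Kernel S S :=
  Kernel.ofFunOfCountable fun x => (jumpPMF Q x).toMeasure

instance (Q : Matrix S S ℝ) : IsMarkovKernel (jumpKernel Q) :=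
  ⟨fun x => PMF.toMeasure.isProbabilityMeasure (jumpPMF Q x)⟩

/-- The same kernel, reading the last state of a finite history. -/
def historyKernel (Q : Matrix S S ℝ) (n : ℕ) : Kernel (Finset.Iic n → S) S :=
  (jumpKernel Q).comap (fun h => h ⟨n, Finset.mem_Iic.2 le_rfl⟩) (measurable_pi_apply _)

instance (Q : Matrix S S ℝ) (n : ℕ) : IsMarkovKernel (historyKernel Q n) := by
  unfold historyKernel; infer_instance

/-- The law of the jump chain started in `x`. -/
def jumpChainLaw (Q : Matrix S S ℝ) (x : S) : Measure (ℕ → S) :=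
  Kernel.trajMeasure (X := fun _ => S) (Measure.dirac x) (historyKernel Q)

/-- The sample space of the process consists of the pairs (jump chain, sequence of standard
exponential variables); this is the law under which the process starts in `x`. -/
def law (Q : Matrix S S ℝ) (x : S) : Measure ((ℕ → S) × (ℕ → ℝ)) :=
  (jumpChainLaw Q x).prod (Measure.infinitePi fun _ : ℕ => expMeasure 1)

/-- The holding time in the `n`-th visited state `ω.1 n`: a standard exponential variable divided
by the total intensity out of that state. -/
def holdingTime (Q : Matrix S S ℝ) (ω : (ℕ → S) × (ℕ → ℝ)) (n : ℕ) : ℝ≥0∞ :=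
  ENNReal.ofReal (ω.2 n) / exitRate Q (ω.1 n)

/-- The time of the `n`-th jump, with `jumpTime Q ω 0 = 0`. -/
def jumpTime (Q : Matrix S S ℝ) (ω : (ℕ → S) × (ℕ → ℝ)) (n : ℕ) : ℝ≥0∞ :=
  ∑ k ∈ Finset.range n, holdingTime Q ω k

/-- The state of the process at time `t`, namely the `n`-th visited state if `t` lies between the
`n`-th and the `(n+1)`-st jump; `none` after an explosion. -/
def path (Q : Matrix S S ℝ) (ω : (ℕ → S) × (ℕ → ℝ)) (t : ℝ≥0) : Option S :=
  open Classical in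
  if h : ∃ n, jumpTime Q ω n ≤ t ∧ t < jumpTime Q ω (n + 1) then some (ω.1 h.choose) else none

end CTMC

/-- `π` is a stationary distribution of the chain with generator `Q`: a probability distribution
with `π Q = 0`. -/
def IsStationary {S : Type*} (Q : Matrix S S ℝ) (π : S → ℝ) : Prop :=
  (∀ x, 0 ≤ π x) ∧ HasSum π 1 ∧ ∀ y, HasSum (fun x => π x * Q x y) 0

/-! ### Level-independent quasi-birth-and-death processes -/

/-- The blocks of a level-independent quasi-birth-and-death process with phase space `ι`:
`Q0` (one level up), `Q1` (same level, levels `≥ 1`), `Q2` (one level down) and `Q1b` (within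
level `0`). -/
structure QBD (ι : Type*) where
  Q0 : Matrix ι ι ℝ
  Q1 : Matrix ι ι ℝ
  Q2 : Matrix ι ι ℝ
  Q1b : Matrix ι ι ℝ

section QBD

variable {ι : Type*}

/-- The block tridiagonal generator on the states `(level, phase)`. -/
def QBD.generator (B : QBD ι) : Matrix (ℕ × ι) (ℕ × ι) ℝ := fun x y =>
  if y.1 = x.1 + 1 then B.Q0 x.2 y.2
  else if y.1 = x.1 then (if x.1 = 0 then B.Q1b x.2 y.2 else B.Q1 x.2 y.2)
  else if y.1 + 1 = x.1 then B.Q2 x.2 y.2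
  else 0

/-- The first time at which the process is in level `a` or in level `b` (`∞` if there is none). -/
def QBD.exitTime (B : QBD ι) (a b : ℕ) (ω : (ℕ → ℕ × ι) × (ℕ → ℝ)) : ℝ≥0∞ :=
  ⨅ (t : ℝ≥0) (_ : ∃ x, path B.generator ω t = some x ∧ (x.1 = a ∨ x.1 = b)), (t : ℝ≥0∞)

variable [Countable ι] [MeasurableSpace ι] [MeasurableSingletonClass ι]

/-- The probability `P_k^K(i, j)` that the process started in `(k, i)` leaves the levels strictly
between `0` and `K` and does so by entering `(K, j)`. -/
def QBD.hitProb (B : QBD ι) (k K : ℕ) (i j : ι) : ℝ :=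
  (law B.generator (k, i)).real
    {ω | ∃ t : ℝ≥0, B.exitTime 0 K ω = t ∧ path B.generator ω t = some (K, j)}

/-- The matrix `H`, the elementwise limit (supremum) of the increasing sequence of the matrices
`H_k = P_k^{k+1}`. -/
def QBD.H (B : QBD ι) : Matrix ι ι ℝ := fun i j => ⨆ k : ℕ, B.hitProb k (k + 1) i j

end QBD

/-! ### The tandem network -/

/-- The blocks of the tandem network with arrival rate `lam`, service rates `mu1`, `mu2` and
capacity `m` of the first queue. The level is the number of customers in the second queue, and
`num i` is the number of customers in the first queue in phase `i`. Arrivals are accepted while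
the first queue holds fewer than `m` customers. -/
def tandem {ι : Type*} (num : ι → ℕ) (lam mu1 mu2 : ℝ) (m : ℕ∞) : QBD ι where
  Q0 i j := if num j + 1 = num i then mu1 else 0
  Q1 i j :=
    if num j = num i + 1 then lam
    else if num j = num i then
      -((if (num i : ℕ∞) < m then lam else 0) + (if 0 < num i then mu1 else 0) + mu2)
    else 0
  Q2 i j := if num j = num i then mu2 else 0
  Q1b i j :=
    if num j = num i + 1 then lam
    else if num j = num i then
      -((if (num i : ℕ∞) < m then lam else 0) + (if 0 < num i then mu1 else 0))
    else 0

/-- The tandem network with finite capacity `m` of the first queue: phases `0, …, m`. -/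
def tandemFin (lam mu1 mu2 : ℝ) (m : ℕ) : QBD (Fin (m + 1)) :=
  tandem (fun i => (i : ℕ)) lam mu1 mu2 m

/-- The tandem network with unlimited capacity of the first queue: phases `0, 1, 2, …`. -/
def tandemInf (lam mu1 mu2 : ℝ) : QBD ℕ := tandem (fun i => i) lam mu1 mu2 ⊤

/-- The stability condition for finite capacity `m ≥ 1`. -/
def FiniteStable (lam mu1 mu2 : ℝ) (m : ℕ) : Prop :=
  (lam / mu1 ≠ 1 → lam / mu2 < (1 - (lam / mu1) ^ (m + 1)) / (1 - (lam / mu1) ^ m)) ∧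
  (lam / mu1 = 1 → lam / mu2 < 1 + 1 / (m : ℝ))

/-- `h` is the maximal (Perron–Frobenius) eigenvalue of `A`: it is an eigenvalue, and no complex
eigenvalue of `A` has larger modulus. -/
def IsMaximalEigenvalue {n : Type*} [Fintype n] [DecidableEq n] (A : Matrix n n ℝ) (h : ℝ) :
    Prop :=
  Module.End.HasEigenvalue (Matrix.toLin' A) h ∧
  ∀ z : ℂ, Module.End.HasEigenvalue (Matrix.toLin' (A.map Complex.ofReal)) z → ‖z‖ ≤ h

/-- The function `τ`, whose zero in `(0, 1)` is `η`. -/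
def tau (lam mu1 mu2 z : ℝ) : ℝ :=
  -lam - mu1 - mu2 * (1 - z) + 2 * √(lam * mu1 / z)

end Tandem

end

open Tandem

/-! Every hitting probability is an exit value of the jump chain, i.e. the least nonnegative
solution of the one-step equations off the levels 0 and K (`QBD.hitProb_eq`, `exitVal_le`). Holding
times play no role beyond being positive and finite. A supersolution of the balance inequalities
therefore gives an upper bound, and a finitely supported subsolution gives a lower bound.

Finite capacity. The level rises by at most one per jump, so P_1^{K+1} = P_1^K P_K^{K+1}
(`QBD.hit_succ`), and these one-level factors increase to H. All columns of H are positive except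
that of the full first queue, which vanishes, so H has a positive Perron eigenvector v with
eigenvalue h. The factors lie eventually between qH and H for any q < 1; applying their product to v
shows growth like h^K (`tandem_tendsto_log_hitProb`). That h < 1 is the drift condition: stability
says that the throughput of the first queue is below mu2, and perturbing a solution of the Poisson
equation of that queue gives a supersolution growing like z^k with z > 1
(`exists_growing_supersolution`), whence zh ≤ 1.

Infinite capacity. Take trial functions z^{-k} x^n. In the interior, the balance is governed by the
quadratic lam x^2 - (lam + mu1 + mu2 (1 - z)) x + mu1 / z, whose roots are nonreal exactly when
tau(z) > 0. A further inequality arises at the empty first queue. For mu1 ≤ mu2 the double root at z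
= η meets it, giving the upper bound; for z < η the absence of real roots yields subsolutions on
finitely many phases. For mu1 > mu2 the function (mu2/lam)^{k+n} is harmonic and gives rate lam/mu2;
the matching subsolutions are truncated differences of two powers. `tandemInf_le_hitProb` turns
either kind into a lower bound.

Stationarity is the product form, with uniqueness from irreducibility. The decay rates differ
because tau(lam/mu2) = 2√(mu1 mu2) - (mu1 + mu2) is negative when mu1 ≠ mu2. -/

noncomputable section

namespace Tandem

/-! ### Exit values of the jump chain -/

section ExitValue

variable {S : Type*}

/-- The expectation of `b` at the exit from `C`, on the event that the jump chain leaves `C` in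
fewer than `n` steps. -/
def valIter (Q : Matrix S S ℝ) (C : Set S) (b : S → ℝ≥0∞) : ℕ → S → ℝ≥0∞
  | 0, _ => 0
  | n + 1, x => open Classical in
      if x ∈ C then ∑' z, jumpPMF Q x z * valIter Q C b n z else b x

/-- The expectation of `b` at the exit of the jump chain from `C`. -/
def exitVal (Q : Matrix S S ℝ) (C : Set S) (b : S → ℝ≥0∞) (x : S) : ℝ≥0∞ :=
  ⨆ n, valIter Q C b n x

/-- The probability that the jump chain started in `x` is in `y` at time `n` and in `C` before. -/
def pathWeight (Q : Matrix S S ℝ) (C : Set S) : ℕ → S → S → ℝ≥0∞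
  | 0, x, y => open Classical in if x = y then 1 else 0
  | n + 1, x, y => open Classical in
      ∑' z, (if z ∈ C then pathWeight Q C n x z else 0) * jumpPMF Q z y

variable (Q : Matrix S S ℝ) (C : Set S)

-- The law of the chain is built by appending a last step, whereas exit values satisfy first-step
-- equations. Exchanging the two sums in the induction passes from one decomposition to the other.
open Classical in
lemma pathWeight_succ' (n : ℕ) (x y : S) : pathWeight Q C (n + 1) x y =
    if x ∈ C then ∑' z, jumpPMF Q x z * pathWeight Q C n z y else 0 := by
  induction n generalizing y with
  | zero =>
    rw [pathWeight]
    rw [tsum_eq_single x]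
    · by_cases hx : x ∈ C
      · simp only [hx, if_true, pathWeight]
        rw [tsum_eq_single y]
        · simp
        · intro z hz; simp [hz]
      · simp [hx]
    · intro z hz
      simp [pathWeight, hz.symm]
  | succ n ih =>
    rw [pathWeight]
    by_cases hx : x ∈ C
    · simp only [hx, if_true] at ih ⊢
      calc _ = ∑' z, ∑' w, jumpPMF Q x w * ((if z ∈ C then pathWeight Q C n w z else 0) *
                jumpPMF Q z y) := by
            refine tsum_congr fun z => ?_
            rw [ih]
            split_ifs
            · rw [← ENNReal.tsum_mul_right]
              refine tsum_congr fun w => ?_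
              ring
            · simp
        _ = _ := by
            rw [ENNReal.tsum_comm]
            refine tsum_congr fun w => ?_
            rw [ENNReal.tsum_mul_left]
            rfl
    · simp only [hx, if_false] at ih ⊢
      simp [ih]

-- Since y lies outside C, a path is stopped on its first arrival there, so the weights over arrival
-- times add up without double counting.
open Classical in
lemma sum_pathWeight {y : S} (hy : y ∉ C) (n : ℕ) (x : S) :
    ∑ m ∈ Finset.range n, pathWeight Q C m x y
      = valIter Q C (Set.indicator {y} 1) n x := by
  induction n generalizing x with
  | zero => simp [valIter]
  | succ n ih =>
    rw [Finset.sum_range_succ', valIter]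
    simp only [pathWeight_succ']
    by_cases hx : x ∈ C
    · have hxy : x ≠ y := fun h => hy (h ▸ hx)
      simp only [hx, if_true, pathWeight, hxy, if_false, add_zero, ← ih]
      rw [← Summable.tsum_finsetSum (fun _ _ => ENNReal.summable)]
      simp only [Finset.mul_sum]
    · simp [hx, pathWeight, Set.indicator_apply]

lemma tsum_pathWeight {y : S} (hy : y ∉ C) (x : S) :
    ∑' m, pathWeight Q C m x y = exitVal Q C (Set.indicator {y} 1) x := by
  rw [ENNReal.tsum_eq_iSup_nat, exitVal]
  simp only [sum_pathWeight Q C hy]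

variable [Countable S] [MeasurableSpace S] [MeasurableSingletonClass S]

lemma jumpChainLaw_zero (x : S) : (jumpChainLaw Q x).map (fun ω => ω 0) = Measure.dirac x := by
  have h : (jumpChainLaw Q x).map (Preorder.frestrictLe (π := fun _ => S) 0)
      = (Measure.dirac x).map (MeasurableEquiv.piUnique (fun _ : Finset.Iic 0 => S)).symm := by
    rw [jumpChainLaw, Kernel.trajMeasure, Measure.map_comp _ _ (by fun_prop),
      Kernel.traj_map_frestrictLe, Kernel.partialTraj_self, Measure.id_comp]
  have h2 : (fun ω : ℕ → S => ω 0) =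
    (fun h : Finset.Iic 0 → S => h ⟨0, by simp⟩) ∘ (Preorder.frestrictLe (π := fun _ => S) 0) := rfl
  rw [h2, ← Measure.map_map (by fun_prop) (by fun_prop), h, Measure.map_map (by fun_prop)
    (by fun_prop)]
  exact Measure.map_id

instance (x : S) : IsProbabilityMeasure (jumpChainLaw Q x) := by
  unfold jumpChainLaw; infer_instance

lemma measurableSet_stay (n : ℕ) (y : S) :
    MeasurableSet {ω : ℕ → S | (∀ k < n, ω k ∈ C) ∧ ω n = y} := by
  have : {ω : ℕ → S | (∀ k < n, ω k ∈ C) ∧ ω n = y}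
      = (⋂ k : ℕ, ⋂ _ : k < n, (fun ω => ω k) ⁻¹' C) ∩ (fun ω => ω n) ⁻¹' {y} := by
    ext ω; simp
  rw [this]
  exact (MeasurableSet.iInter fun k => MeasurableSet.iInter fun _ =>
    (measurable_pi_apply k) (Set.to_countable C).measurableSet).inter
    ((measurable_pi_apply n) (measurableSet_singleton y))

/-- The event at time n + 1 is partitioned by the state at time n. On each piece the Markov
property, in the form of the composition product of the law of the history with the next-step
kernel, splits off one jump probability. -/
lemma jumpChainLaw_stay (n : ℕ) (x y : S) :
    jumpChainLaw Q x {ω | (∀ k < n, ω k ∈ C) ∧ ω n = y} = pathWeight Q C n x y := by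
  classical
  induction n generalizing y with
  | zero =>
    have := congrArg (fun μ => μ {y}) (jumpChainLaw_zero Q x)
    rw [Measure.map_apply (by fun_prop) (measurableSet_singleton y)] at this
    simp only [not_lt_zero, IsEmpty.forall_iff, implies_true, true_and, pathWeight]
    refine this.trans ?_
    rw [Measure.dirac_apply' _ (measurableSet_singleton y)]
    simp [Set.indicator_apply]
  | succ n ih =>
    set μ := jumpChainLaw Q x with hμ
    have hstep : ∀ z, μ {ω | ((∀ k < n + 1, ω k ∈ C) ∧ ω (n + 1) = y) ∧ ω n = z}
        = (if z ∈ C then pathWeight Q C n x z else 0) * jumpPMF Q z y := by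
      intro z
      by_cases hz : z ∈ C
      · simp only [hz, if_true]
        let A : Set (Finset.Iic n → S) :=
          {h | (∀ k (hk : k < n), h ⟨k, Finset.mem_Iic.2 hk.le⟩ ∈ C) ∧
            h ⟨n, Finset.mem_Iic.2 le_rfl⟩ = z}
        have hA : MeasurableSet A := (Set.to_countable A).measurableSet
        have key := congrArg (fun ν => ν (A ×ˢ {y}))
          (Kernel.map_frestrictLe_trajMeasure_compProd_eq_map_trajMeasure
            (X := fun _ => S) (μ₀ := Measure.dirac x) (κ := historyKernel Q) (a := n))
        rw [Measure.map_apply (by fun_prop) (hA.prod (measurableSet_singleton y)),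
          Measure.compProd_apply_prod hA (measurableSet_singleton y)] at key
        have h1 : {ω : ℕ → S | ((∀ k < n + 1, ω k ∈ C) ∧ ω (n + 1) = y) ∧ ω n = z} =
            (fun ω : ℕ → S => (Preorder.frestrictLe (π := fun _ => S) n ω, ω (n + 1))) ⁻¹'
              (A ×ˢ {y}) := by
          ext ω
          simp only [Set.mem_ofPred_eq, Set.mem_preimage, Set.mem_prod, Set.mem_singleton_iff, A,
            Preorder.frestrictLe_apply]
          constructor
          · rintro ⟨⟨h1, h2⟩, h3⟩
            exact ⟨⟨fun k hk => h1 k (by omega), h3⟩, h2⟩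
          · rintro ⟨⟨h1, h3⟩, h2⟩
            refine ⟨⟨fun k hk => ?_, h2⟩, h3⟩
            rcases Nat.lt_succ_iff_lt_or_eq.1 hk with h | h
            · exact h1 k h
            · rw [h, h3]; exact hz
        rw [h1]
        refine key.symm.trans ?_
        have h2 : ∀ h ∈ A, historyKernel Q n h {y} = jumpPMF Q z y := by
          rintro h ⟨-, hh⟩
          rw [historyKernel, Kernel.comap_apply, hh]
          exact PMF.toMeasure_apply_singleton _ _ (measurableSet_singleton y)
        rw [setLIntegral_congr_fun hA h2, lintegral_const, mul_comm,
          Measure.restrict_apply MeasurableSet.univ, Set.univ_inter,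
          Measure.map_apply (by fun_prop) hA, ← ih z]
        congr 2
      · simp only [hz, if_false, zero_mul]
        convert measure_empty (μ := μ)
        ext ω
        simp only [Set.mem_ofPred_eq, Set.mem_empty_iff_false, iff_false]
        rintro ⟨⟨h1, -⟩, h2⟩
        exact hz (h2 ▸ h1 n (Nat.lt_succ_self n))
    rw [pathWeight]
    simp only [← hstep]
    rw [← measure_iUnion]
    · congr 1
      ext ω
      simp
    · intro z w hzw
      rw [Function.onFun, Set.disjoint_left]
      rintro ω ⟨-, h1⟩ ⟨-, h2⟩
      exact hzw (h1.symm.trans h2)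
    · intro z
      have : {ω : ℕ → S | ((∀ k < n + 1, ω k ∈ C) ∧ ω (n + 1) = y) ∧ ω n = z}
          = {ω : ℕ → S | (∀ k < n + 1, ω k ∈ C) ∧ ω (n + 1) = y} ∩ (fun ω => ω n) ⁻¹' {z} := rfl
      rw [this]
      exact (measurableSet_stay C (n + 1) y).inter
        ((measurable_pi_apply n) (measurableSet_singleton z))

lemma jumpChainLaw_exit {y : S} (hy : y ∉ C) (x : S) :
    jumpChainLaw Q x {ω | ∃ n, (∀ k < n, ω k ∈ C) ∧ ω n = y}
      = exitVal Q C (Set.indicator {y} 1) x := by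
  rw [← tsum_pathWeight Q C hy, Set.ofPred_exists, measure_iUnion]
  · simp only [jumpChainLaw_stay]
  · intro n m hnm
    rw [Function.onFun, Set.disjoint_left]
    rintro ω ⟨h1, h2⟩ ⟨h3, h4⟩
    rcases lt_or_gt_of_ne hnm with h | h
    · exact hy (h2 ▸ h3 n h)
    · exact hy (h4 ▸ h1 m h)
  · exact fun n => measurableSet_stay C n y

end ExitValue

/-! ### The first exit of the process -/

section Path

variable {S : Type*} {Q : Matrix S S ℝ} {ω : (ℕ → S) × (ℕ → ℝ)}

lemma jumpTime_strictMono (h0 : ∀ x, exitRate Q x ≠ ∞) (h1 : ∀ x, exitRate Q x ≠ 0)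
    (hω : ∀ n, 0 < ω.2 n) : StrictMono (jumpTime Q ω) ∧ ∀ n, jumpTime Q ω n ≠ ∞ := by
  have hfin : ∀ n, holdingTime Q ω n ≠ ∞ := fun n =>
    ENNReal.div_ne_top ENNReal.ofReal_ne_top (h1 _)
  have hpos : ∀ n, holdingTime Q ω n ≠ 0 := fun n =>
    (ENNReal.div_pos (by simpa using hω n) (h0 _)).ne'
  have hJ : ∀ n, jumpTime Q ω n ≠ ∞ := fun n => ENNReal.sum_ne_top.2 fun k _ => hfin k
  refine ⟨strictMono_nat_of_lt_succ fun n => ?_, hJ⟩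
  have : jumpTime Q ω (n + 1) = jumpTime Q ω n + holdingTime Q ω n := Finset.sum_range_succ _ _
  rw [this]
  exact ENNReal.lt_add_right (hJ n) (hpos n)

/-- Strictly increasing jump times leave only one index for the interval containing t, so the index
taken by choice in `path` is n. -/
lemma path_of_mem (hJ : StrictMono (jumpTime Q ω)) {n : ℕ} {t : ℝ≥0} (h1 : jumpTime Q ω n ≤ t)
    (h2 : t < jumpTime Q ω (n + 1)) : path Q ω t = some (ω.1 n) := by
  have h : ∃ n, jumpTime Q ω n ≤ t ∧ t < jumpTime Q ω (n + 1) := ⟨n, h1, h2⟩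
  rw [path, dif_pos h]
  have hc := h.choose_spec
  have a := hJ.lt_iff_lt.1 (h1.trans_lt hc.2)
  have b := hJ.lt_iff_lt.1 (hc.1.trans_lt h2)
  rw [show h.choose = n by omega]

lemma exists_of_path_eq {t : ℝ≥0} {x : S} (h : path Q ω t = some x) :
    ∃ n, jumpTime Q ω n ≤ t ∧ t < jumpTime Q ω (n + 1) ∧ ω.1 n = x := by
  rw [path] at h
  split_ifs at h with h'
  exact ⟨h'.choose, h'.choose_spec.1, h'.choose_spec.2, Option.some.inj h⟩

end Path

section Hit

variable {ι : Type*}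

/-- The states strictly off the levels `0` and `K`. -/
def offLevels (ι : Type*) (K : ℕ) : Set (ℕ × ι) := {x | x.1 ≠ 0 ∧ x.1 ≠ K}

/-- Every visited state is occupied on a nondegenerate time interval starting at its jump time, so
the first time at a boundary level is the jump time of the first boundary state. Only the strict
increase and finiteness of jump times matter; nonexplosion is not needed. -/
lemma QBD.exit_iff (B : QBD ι) (K : ℕ) (j : ι) {ω : (ℕ → ℕ × ι) × (ℕ → ℝ)}
    (hJ : StrictMono (jumpTime B.generator ω)) (hfin : ∀ n, jumpTime B.generator ω n ≠ ∞) :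
    (∃ t : ℝ≥0, B.exitTime 0 K ω = t ∧ path B.generator ω t = some (K, j)) ↔
      ∃ n, (∀ k < n, ω.1 k ∈ offLevels ι K) ∧ ω.1 n = (K, j) := by
  have hle : ∀ n, ω.1 n ∉ offLevels ι K → B.exitTime 0 K ω ≤ jumpTime B.generator ω n := by
    intro n hn
    have ht : ((jumpTime B.generator ω n).toNNReal : ℝ≥0∞) = jumpTime B.generator ω n :=
      ENNReal.coe_toNNReal (hfin n)
    rw [← ht]
    refine iInf₂_le _ ⟨ω.1 n, path_of_mem hJ ht.ge (ht.le.trans_lt (hJ (Nat.lt_succ_self n))), ?_⟩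
    by_contra hcon
    push Not at hcon
    exact hn hcon
  constructor
  · rintro ⟨t, ht, hp⟩
    obtain ⟨n, h1, h2, h3⟩ := exists_of_path_eq hp
    refine ⟨n, fun k hk => ?_, h3⟩
    by_contra hcon
    have := hle k hcon
    rw [ht] at this
    exact absurd (h1.trans this) (not_le.2 (hJ hk))
  · rintro ⟨n, h1, h2⟩
    have ht : ((jumpTime B.generator ω n).toNNReal : ℝ≥0∞) = jumpTime B.generator ω n :=
      ENNReal.coe_toNNReal (hfin n)
    refine ⟨(jumpTime B.generator ω n).toNNReal, le_antisymm ?_ ?_, ?_⟩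
    · rw [ht]
      exact hle n (by rw [h2]; simp [offLevels])
    · rw [ht]
      refine le_iInf₂ fun s hs => ?_
      obtain ⟨x, hx, hl⟩ := hs
      obtain ⟨n', h3, h4, h5⟩ := exists_of_path_eq hx
      refine le_trans (hJ.monotone ?_) h3
      by_contra hcon
      have := h1 n' (not_le.1 hcon)
      rw [h5] at this
      rcases hl with h | h
      · exact this.1 h
      · exact this.2 h
    · rw [← h2]
      exact path_of_mem hJ ht.ge (ht.le.trans_lt (hJ (Nat.lt_succ_self n)))

variable [Countable ι] [MeasurableSpace ι] [MeasurableSingletonClass ι]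

lemma expMeasure_Iic_zero : expMeasure 1 (Set.Iic (0 : ℝ)) = 0 := by
  have : IsProbabilityMeasure (expMeasure 1) := isProbabilityMeasure_expMeasure one_pos
  have := cdf_expMeasure_eq one_pos 0
  rw [cdf_eq_real] at this
  simpa [measureReal_eq_zero_iff] using this

lemma ae_holding_pos (Q : Matrix ι ι ℝ) (x : ι) : ∀ᵐ ω ∂(law Q x), ∀ n, 0 < ω.2 n := by
  have : IsProbabilityMeasure (expMeasure 1) := isProbabilityMeasure_expMeasure one_pos
  have h : ∀ᵐ v ∂(Measure.infinitePi fun _ : ℕ => expMeasure 1), ∀ n, 0 < v n := by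
    refine ae_all_iff.2 fun n => ?_
    have h1 : ∀ᵐ t ∂(expMeasure 1), 0 < t := by
      rw [ae_iff]
      simpa [Set.Iic] using expMeasure_Iic_zero
    have h2 := (measurePreserving_eval_infinitePi (fun _ : ℕ => expMeasure 1) n)
    exact h2.quasiMeasurePreserving.ae h1
  exact (Measure.quasiMeasurePreserving_snd).ae h

/-- The hitting probability, in terms of the jump chain. -/
lemma QBD.hitProb_eq (B : QBD ι) (h0 : ∀ x, exitRate B.generator x ≠ ∞)
    (h1 : ∀ x, exitRate B.generator x ≠ 0) (k K : ℕ) (i j : ι) :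
    B.hitProb k K i j = (exitVal B.generator (offLevels ι K)
      (Set.indicator {(K, j)} 1) (k, i)).toReal := by
  have : IsProbabilityMeasure (expMeasure 1) := isProbabilityMeasure_expMeasure one_pos
  rw [← jumpChainLaw_exit _ _ (by simp [offLevels]), hitProb, measureReal_def]
  congr 1
  set E : Set (ℕ → ℕ × ι) := {ω | ∃ n, (∀ k < n, ω k ∈ offLevels ι K) ∧ ω n = (K, j)}
  have : law B.generator (k, i)
      {ω | ∃ t : ℝ≥0, B.exitTime 0 K ω = t ∧ path B.generator ω t = some (K, j)}
      = law B.generator (k, i) (E ×ˢ Set.univ) := by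
    refine measure_congr ?_
    filter_upwards [ae_holding_pos B.generator (k, i)] with ω hω
    obtain ⟨hJ, hfin⟩ := jumpTime_strictMono h0 h1 hω
    refine propext ((B.exit_iff K j hJ hfin).trans ?_)
    show _ ↔ ω ∈ E ×ˢ (Set.univ : Set (ℕ → ℝ))
    simp [E]
  rw [this, law, Measure.prod_prod]
  simp

end Hit

/-! ### Exit values as least solutions of the one-step equations -/

section ExitValue

variable {S : Type*} {Q : Matrix S S ℝ} {C : Set S} {b : S → ℝ≥0∞}

lemma jumpPMF_eq {x : S} (h0 : exitRate Q x ≠ 0) (h1 : exitRate Q x ≠ ∞) (z : S) :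
    jumpPMF Q x z = rate Q x z * (exitRate Q x)⁻¹ := by
  rw [jumpPMF, dif_pos ⟨h0, h1⟩]
  exact PMF.normalize_apply _ _ _

lemma exitRate_mul_tsum_jumpPMF {x : S} (h0 : exitRate Q x ≠ 0) (h1 : exitRate Q x ≠ ∞)
    (g : S → ℝ≥0∞) :
    exitRate Q x * ∑' z, jumpPMF Q x z * g z = ∑' z, rate Q x z * g z := by
  rw [← ENNReal.tsum_mul_left]
  refine tsum_congr fun z => ?_
  rw [jumpPMF_eq h0 h1, ← mul_assoc, mul_comm (exitRate Q x), mul_assoc (rate Q x z),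
    ENNReal.inv_mul_cancel h0 h1, mul_one]

lemma valIter_succ_of_mem {x : S} (hx : x ∈ C) (n : ℕ) :
    valIter Q C b (n + 1) x = ∑' z, jumpPMF Q x z * valIter Q C b n z := by
  simp [valIter, hx]

lemma valIter_succ_of_notMem {x : S} (hx : x ∉ C) (n : ℕ) : valIter Q C b (n + 1) x = b x := by
  simp [valIter, hx]

lemma valIter_mono (x : S) : Monotone fun n => valIter Q C b n x := by
  refine monotone_nat_of_le_succ fun n => ?_
  induction n generalizing x with
  | zero => exact zero_le
  | succ n ih =>
    by_cases hx : x ∈ C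
    · simp only [valIter_succ_of_mem hx]
      exact ENNReal.tsum_le_tsum fun z => mul_le_mul_right (ih z) _
    · simp only [valIter_succ_of_notMem hx, le_refl]

lemma tsum_iSup_of_monotone {α : Type*} {f : ℕ → α → ℝ≥0∞} (hf : ∀ a, Monotone fun n => f n a) :
    ∑' a, ⨆ n, f n a = ⨆ n, ∑' a, f n a := by
  let _ : MeasurableSpace α := ⊤
  simp only [← lintegral_count]
  exact lintegral_iSup (fun _ => measurable_from_top) fun n m h a => hf a h

lemma exitVal_of_notMem {x : S} (hx : x ∉ C) : exitVal Q C b x = b x := by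
  refine le_antisymm (iSup_le fun n => ?_) ?_
  · cases n with
    | zero => exact zero_le
    | succ n => rw [valIter_succ_of_notMem hx]
  · rw [← valIter_succ_of_notMem (Q := Q) (b := b) hx 0]
    exact le_iSup (fun n => valIter Q C b n x) 1

/-- Monotone convergence carries the recursion of the increasing iterates to their supremum. -/
lemma exitVal_of_mem {x : S} (hx : x ∈ C) :
    exitVal Q C b x = ∑' z, jumpPMF Q x z * exitVal Q C b z := by
  simp only [exitVal, ENNReal.mul_iSup]
  rw [tsum_iSup_of_monotone (f := fun n z => jumpPMF Q x z * valIter Q C b n z)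
    fun z n m h => mul_le_mul_right (valIter_mono z h) _]
  simp only [← valIter_succ_of_mem hx]
  refine le_antisymm (iSup_le fun n => ?_) (iSup_le fun n => ?_)
  · exact (valIter_mono x (Nat.le_succ n)).trans (le_iSup (fun n => valIter Q C b (n + 1) x) n)
  · exact le_iSup (fun n => valIter Q C b n x) (n + 1)

/-- Comparison principle: each iterate stays below a nonnegative supersolution, by induction on the
number of steps. Nothing is assumed about the chain leaving C with probability one. -/
lemma exitVal_le {g : S → ℝ≥0∞} (hb : ∀ x, x ∉ C → b x ≤ g x)
    (hg : ∀ x, x ∈ C → ∑' z, jumpPMF Q x z * g z ≤ g x) (x : S) : exitVal Q C b x ≤ g x := by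
  refine iSup_le fun n => ?_
  induction n generalizing x with
  | zero => exact zero_le
  | succ n ih =>
    by_cases hx : x ∈ C
    · rw [valIter_succ_of_mem hx]
      exact (ENNReal.tsum_le_tsum fun z => mul_le_mul_right (ih z) _).trans (hg x hx)
    · rw [valIter_succ_of_notMem hx]
      exact hb x hx

lemma exitVal_le_of_rate {g : S → ℝ≥0∞} (h0 : ∀ x, exitRate Q x ≠ 0) (h1 : ∀ x, exitRate Q x ≠ ∞)
    (hb : ∀ x, x ∉ C → b x ≤ g x)
    (hg : ∀ x, x ∈ C → ∑' z, rate Q x z * g z ≤ exitRate Q x * g x) (x : S) :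
    exitVal Q C b x ≤ g x := by
  refine exitVal_le hb (fun x hx => ?_) x
  have := hg x hx
  rw [← exitRate_mul_tsum_jumpPMF (h0 x) (h1 x)] at this
  exact (ENNReal.mul_le_mul_iff_right (h0 x) (h1 x)).1 this

lemma exitRate_mul_exitVal (h0 : ∀ x, exitRate Q x ≠ 0) (h1 : ∀ x, exitRate Q x ≠ ∞) {x : S}
    (hx : x ∈ C) :
    exitRate Q x * exitVal Q C b x = ∑' z, rate Q x z * exitVal Q C b z := by
  rw [exitVal_of_mem hx, exitRate_mul_tsum_jumpPMF (h0 x) (h1 x)]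

lemma exitVal_le_one (hb : ∀ x, b x ≤ 1) (x : S) : exitVal Q C b x ≤ 1 :=
  exitVal_le (g := 1) (fun x _ => hb x) (fun x _ => by simp [PMF.tsum_coe]) x

/-- Exit values are linear in the boundary datum, already at the level of iterates. -/
lemma exitVal_eq_tsum (x : S) :
    exitVal Q C b x = ∑' y, b y * exitVal Q C (Set.indicator {y} 1) x := by
  have key : ∀ n x, valIter Q C b n x = ∑' y, b y * valIter Q C (Set.indicator {y} 1) n x := by
    intro n
    induction n with
    | zero => simp [valIter]
    | succ n ih =>
      intro x
      by_cases hx : x ∈ C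
      · simp only [valIter_succ_of_mem hx, ih, ← ENNReal.tsum_mul_left]
        rw [ENNReal.tsum_comm]
        simp only [mul_left_comm]
      · simp only [valIter_succ_of_notMem hx]
        rw [tsum_eq_single x]
        · simp
        · intro y hy; simp [hy.symm]
  simp only [exitVal, key, ENNReal.mul_iSup]
  rw [tsum_iSup_of_monotone]
  exact fun y n m h => mul_le_mul_right (valIter_mono x h) _

end ExitValue

/-! ### Hitting probabilities of level-independent processes -/

section QBD

variable {ι : Type*} (B : QBD ι)

/-- The probability of hitting the levels `{0, K}` for the first time in `(K, j)`. -/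
def QBD.hit (K : ℕ) (x : ℕ × ι) (j : ι) : ℝ≥0∞ :=
  exitVal B.generator (offLevels ι K) (Set.indicator {(K, j)} 1) x

variable {B}

lemma QBD.hit_le_one (K : ℕ) (x : ℕ × ι) (j : ι) : B.hit K x j ≤ 1 :=
  exitVal_le_one (b := Set.indicator {(K, j)} 1)
    (fun _ => Set.indicator_apply_le' (fun _ => le_rfl) fun _ => zero_le) x

lemma QBD.hit_ne_top (K : ℕ) (x : ℕ × ι) (j : ι) : B.hit K x j ≠ ∞ :=
  ne_top_of_le_ne_top ENNReal.one_ne_top (hit_le_one K x j)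

lemma QBD.hit_top_level [DecidableEq ι] (K : ℕ) (i j : ι) :
    B.hit K (K, i) j = if i = j then 1 else 0 := by
  rw [hit, exitVal_of_notMem (by simp [offLevels])]
  simp [Set.indicator_apply]

lemma QBD.exitVal_level (K : ℕ) (φ : ι → ℝ≥0∞) (x : ℕ × ι) :
    exitVal B.generator (offLevels ι K) (fun z => if z.1 = K then φ z.2 else 0) x
      = ∑' l, B.hit K x l * φ l := by
  have hinj : Function.Injective (fun l : ι => (K, l)) := fun a b h => (Prod.mk.inj h).2
  rw [exitVal_eq_tsum, ← hinj.tsum_eq]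
  · refine tsum_congr fun l => ?_
    simp only [if_true]
    rw [mul_comm]
    rfl
  · rintro ⟨l', l⟩ h
    by_cases hl : l' = K
    · exact ⟨l, by simp [hl]⟩
    · simp [hl] at h

lemma QBD.rate_eq_zero {x z : ℕ × ι} (h : x.1 + 1 < z.1) : rate B.generator x z = 0 := by
  rw [rate]
  split_ifs
  · rfl
  · rw [generator, if_neg (by omega), if_neg (by omega), if_neg (by omega), ENNReal.ofReal_zero]

lemma QBD.rate_shift {l l' : ℕ} (hl : l ≠ 0) (i j : ι) :
    rate B.generator (l + 1, i) (l' + 1, j) = rate B.generator (l, i) (l', j) := by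
  have h : (l + 1, i) = (l' + 1, j) ↔ (l, i) = (l', j) := by simp
  by_cases h' : (l, i) = (l', j)
  · rw [rate, rate, if_pos (h.2 h'), if_pos h']
  · rw [rate, rate, if_neg (mt h.1 h'), if_neg h']
    simp only [generator, add_left_inj, hl, if_false, Nat.succ_ne_zero]

lemma QBD.rate_shift_zero {l : ℕ} (hl : l ≠ 0) (i j : ι) :
    rate B.generator (l + 1, i) (0, j) = 0 := by
  simp [rate, generator, hl]

lemma QBD.exitRate_shift {l : ℕ} (hl : l ≠ 0) (i : ι) :
    exitRate B.generator (l + 1, i) = exitRate B.generator (l, i) := by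
  have hinj : Function.Injective (fun z : ℕ × ι => (z.1 + 1, z.2)) := by
    rintro ⟨a, b⟩ ⟨c, d⟩ h; simpa using h
  rw [exitRate, exitRate, ← hinj.tsum_eq]
  · exact tsum_congr fun z => rate_shift hl i z.2
  · rintro ⟨_ | l', j⟩ h
    · exact absurd (rate_shift_zero hl i j) h
    · exact ⟨(l', j), rfl⟩

/-! ### Factorisation by levels and monotonicity in the level -/

section Decomposition

/-- A path that reaches K + 1 from below must first pass through level K, because jumps raise the
level by at most one. Both inequalities are proved on iterates, restricted to levels at most K:
there no jump skips over K, and the values at level K are by choice of b those of the larger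
problem. -/
lemma QBD.hit_succ
    (h0 : ∀ x, exitRate B.generator x ≠ 0) (h1 : ∀ x, exitRate B.generator x ≠ ∞)
    {K k : ℕ} (hk : k ≤ K) (i j : ι) :
    B.hit (K + 1) (k, i) j = ∑' l, B.hit K (k, i) l * B.hit (K + 1) (K, l) j := by
  classical
  set g : ℕ × ι → ℝ≥0∞ := fun x => B.hit (K + 1) x j with hg
  set b : ℕ × ι → ℝ≥0∞ := fun x => if x.1 = K then g (K, x.2) else 0 with hb
  have hskip : ∀ (x z : ℕ × ι), x.1 < K → K < z.1 → jumpPMF B.generator x z = 0 := by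
    intro x z hx hz
    rw [jumpPMF_eq (h0 x) (h1 x), rate_eq_zero (by omega), zero_mul]
  have hge : ∀ n x, x.1 ≤ K → valIter B.generator (offLevels ι (K + 1))
      (Set.indicator {(K + 1, j)} 1) n x ≤ exitVal B.generator (offLevels ι K) b x := by
    intro n
    induction n with
    | zero => exact fun _ _ => zero_le
    | succ n ih =>
      intro x hx
      rcases eq_or_ne x.1 0 with hx0 | hx0
      · rw [valIter_succ_of_notMem (by simp [offLevels, hx0]), Set.indicator_of_notMem]
        · exact zero_le
        · rintro rfl; simp at hx0
      rcases eq_or_ne x.1 K with hxK | hxK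
      · rw [exitVal_of_notMem (by simp [offLevels, hxK])]
        have hx' : (K, x.2) = x := Prod.ext hxK.symm rfl
        simp only [hb, hxK, if_true, hx']
        exact le_iSup (fun n => valIter _ _ _ n x) _
      · rw [exitVal_of_mem (C := offLevels ι K) ⟨hx0, hxK⟩,
          valIter_succ_of_mem (C := offLevels ι (K + 1)) ⟨hx0, by omega⟩]
        refine ENNReal.tsum_le_tsum fun z => ?_
        by_cases hz : z.1 ≤ K
        · exact mul_le_mul_right (ih z hz) _
        · rw [hskip x z (by omega) (by omega), zero_mul, zero_mul]
  have hle : ∀ n x, x.1 ≤ K → valIter B.generator (offLevels ι K) b n x ≤ g x := by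
    intro n
    induction n with
    | zero => exact fun _ _ => zero_le
    | succ n ih =>
      intro x hx
      by_cases hxC : x ∈ offLevels ι K
      · rw [valIter_succ_of_mem hxC, hg]
        simp only [hit]
        have : x ∈ offLevels ι (K + 1) := ⟨hxC.1, by omega⟩
        rw [exitVal_of_mem this]
        refine ENNReal.tsum_le_tsum fun z => ?_
        by_cases hz : z.1 ≤ K
        · exact mul_le_mul_right (ih z hz) _
        · have := hxC.2
          rw [hskip x z (by omega) (by omega), zero_mul, zero_mul]
      · rw [valIter_succ_of_notMem hxC]
        simp only [hb]
        split_ifs with hxK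
        · rw [← hxK]
        · exact zero_le
  have heq : B.hit (K + 1) (k, i) j = exitVal B.generator (offLevels ι K) b (k, i) :=
    le_antisymm (iSup_le fun n => hge n _ hk) (iSup_le fun n => hle n _ hk)
  rw [heq]
  exact exitVal_level K (fun l => g (K, l)) (k, i)

/-- Lift every path by one level. Rates agree at levels other than 0; where the original path is
killed at level 0, the lifted one sits at level 1 and may still succeed. -/
lemma QBD.hit_shift_le
    (h0 : ∀ x, exitRate B.generator x ≠ 0) (h1 : ∀ x, exitRate B.generator x ≠ ∞)
    (k : ℕ) (i j : ι) :
    B.hit (k + 1) (k, i) j ≤ B.hit (k + 2) (k + 1, i) j := by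
  have key : ∀ n l i, valIter B.generator (offLevels ι (k + 1)) (Set.indicator {(k + 1, j)} 1) n
      (l, i) ≤ valIter B.generator (offLevels ι (k + 2)) (Set.indicator {(k + 2, j)} 1) n
        (l + 1, i) := by
    intro n
    induction n with
    | zero => exact fun _ _ => zero_le
    | succ n ih =>
      intro l i
      rcases eq_or_ne l 0 with rfl | hl
      · rw [valIter_succ_of_notMem (by simp [offLevels]), Set.indicator_of_notMem (by simp)]
        exact zero_le
      rcases eq_or_ne l (k + 1) with rfl | hlk
      · rw [valIter_succ_of_notMem (by simp [offLevels]),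
          valIter_succ_of_notMem (by simp [offLevels])]
        rcases eq_or_ne i j with rfl | hij
        · rw [Set.indicator_of_mem (a := (k + 1 + 1, i)) (by simp)]
          exact Set.indicator_apply_le' (fun _ => le_rfl) fun _ => zero_le
        · rw [Set.indicator_of_notMem (by simp [hij])]
          exact zero_le
      · rw [valIter_succ_of_mem (C := offLevels ι (k + 1)) ⟨hl, hlk⟩,
          valIter_succ_of_mem (C := offLevels ι (k + 2))
            ⟨Nat.succ_ne_zero l, fun h => hlk (by simpa using h)⟩]
        have hinj : Function.Injective (fun z : ℕ × ι => (z.1 + 1, z.2)) := by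
          rintro ⟨a, b⟩ ⟨c, d⟩ h; simpa using h
        refine le_trans ?_ (ENNReal.tsum_comp_le_tsum_of_injective hinj _)
        refine ENNReal.tsum_le_tsum fun z => ?_
        rw [jumpPMF_eq (h0 _) (h1 _), jumpPMF_eq (h0 _) (h1 _), exitRate_shift hl, rate_shift hl]
        exact mul_le_mul_right (ih z.1 z.2) _
  exact iSup_mono fun n => key n k i

variable [Countable ι] [MeasurableSpace ι] [MeasurableSingletonClass ι]

lemma QBD.hitProb_eq_hit
    (h0 : ∀ x, exitRate B.generator x ≠ 0) (h1 : ∀ x, exitRate B.generator x ≠ ∞)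
    (k K : ℕ) (i j : ι) : B.hitProb k K i j = (B.hit K (k, i) j).toReal :=
  B.hitProb_eq h1 h0 k K i j

lemma QBD.hitProb_succ
    (h0 : ∀ x, exitRate B.generator x ≠ 0) (h1 : ∀ x, exitRate B.generator x ≠ ∞)
    [Fintype ι] {K k : ℕ} (hk : k ≤ K) (i j : ι) :
    B.hitProb k (K + 1) i j = ∑ l, B.hitProb k K i l * B.hitProb K (K + 1) l j := by
  simp only [hitProb_eq_hit h0 h1]
  rw [hit_succ h0 h1 hk, tsum_fintype, ENNReal.toReal_sum]
  · simp only [ENNReal.toReal_mul]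
  · exact fun l _ => ENNReal.mul_ne_top (hit_ne_top _ _ _) (hit_ne_top _ _ _)

lemma QBD.hitProb_mono
    (h0 : ∀ x, exitRate B.generator x ≠ 0) (h1 : ∀ x, exitRate B.generator x ≠ ∞)
    (i j : ι) : Monotone fun k => B.hitProb k (k + 1) i j := by
  refine monotone_nat_of_le_succ fun k => ?_
  simp only [hitProb_eq_hit h0 h1]
  exact ENNReal.toReal_mono (hit_ne_top _ _ _) (hit_shift_le h0 h1 k i j)

lemma QBD.hitProb_le_one
    (h0 : ∀ x, exitRate B.generator x ≠ 0) (h1 : ∀ x, exitRate B.generator x ≠ ∞)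
    (k K : ℕ) (i j : ι) : B.hitProb k K i j ≤ 1 := by
  rw [hitProb_eq_hit h0 h1]
  exact ENNReal.toReal_le_of_le_ofReal zero_le_one (by simpa using hit_le_one K (k, i) j)

lemma QBD.hitProb_bddAbove
    (h0 : ∀ x, exitRate B.generator x ≠ 0) (h1 : ∀ x, exitRate B.generator x ≠ ∞)
    (i j : ι) :
    BddAbove (Set.range fun k => B.hitProb k (k + 1) i j) :=
  ⟨1, by rintro _ ⟨k, rfl⟩; exact hitProb_le_one h0 h1 _ _ _ _⟩

lemma QBD.tendsto_H
    (h0 : ∀ x, exitRate B.generator x ≠ 0) (h1 : ∀ x, exitRate B.generator x ≠ ∞)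
    (i j : ι) :
    Tendsto (fun k => B.hitProb k (k + 1) i j) atTop (𝓝 (B.H i j)) :=
  tendsto_atTop_ciSup (hitProb_mono h0 h1 i j) (hitProb_bddAbove h0 h1 i j)

lemma QBD.hitProb_le_H
    (h0 : ∀ x, exitRate B.generator x ≠ 0) (h1 : ∀ x, exitRate B.generator x ≠ ∞)
    (k : ℕ) (i j : ι) : B.hitProb k (k + 1) i j ≤ B.H i j :=
  le_ciSup (hitProb_bddAbove h0 h1 i j) k

end Decomposition

end QBD

/-! ### Generator, comparison and positivity for the tandem network -/

section TandemRates

variable {ι : Type*} {num : ι → ℕ} {lam mu1 mu2 : ℝ} {m : ℕ∞}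

lemma tandem_rate (hinj : Function.Injective num) (k : ℕ) (i : ι) (z : ℕ × ι) :
    rate (tandem num lam mu1 mu2 m).generator (k, i) z =
      (if z.1 = k ∧ num z.2 = num i + 1 then ENNReal.ofReal lam else 0) +
      (if z.1 = k + 1 ∧ num z.2 + 1 = num i then ENNReal.ofReal mu1 else 0) +
      (if z.1 + 1 = k ∧ num z.2 = num i then ENNReal.ofReal mu2 else 0) := by
  obtain ⟨l, j⟩ := z
  by_cases h : (k, i) = (l, j)
  · obtain ⟨rfl, rfl⟩ := Prod.mk.inj h
    simp [rate]
  · rw [rate, if_neg h]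
    simp only [QBD.generator, tandem]
    rcases eq_or_ne l (k + 1) with rfl | h1
    · simp only [if_true, true_and]
      have : k + 1 + 1 ≠ k := by omega
      simp only [Nat.succ_ne_self, this, false_and, if_false, add_zero, zero_add]
      split_ifs <;> simp
    rcases eq_or_ne l k with rfl | h2
    · have hij : num j ≠ num i := fun hij => h (by rw [hinj hij])
      simp only [h1, hij, if_false, if_true, true_and, false_and, Nat.succ_ne_self, add_zero]
      split_ifs <;> simp
    · simp only [h1, h2, if_false, false_and, zero_add]
      split_ifs <;> simp_all

lemma tsum_ite_mul (hinj : Function.Injective num) (c : ℝ≥0∞) (g : ℕ × ℕ → ℝ≥0∞) (l n : ℕ)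
    (hn : ∃ j, num j = n) :
    ∑' z : ℕ × ι, (if z.1 = l ∧ num z.2 = n then c else 0) * g (z.1, num z.2) = c * g (l, n) := by
  obtain ⟨j, rfl⟩ := hn
  rw [tsum_eq_single (l, j)]
  · simp
  · rintro ⟨l', j'⟩ h
    rw [if_neg, zero_mul]
    rintro ⟨rfl, h2⟩
    exact h (Prod.ext rfl (hinj h2))

/-- The hypotheses on `num` identify the phases with the integers at most m, so that finite and
infinite capacity are handled together. -/
lemma tandem_tsum_rate (hinj : Function.Injective num)
    (hnum : ∀ n : ℕ, (n : ℕ∞) ≤ m ↔ ∃ i, num i = n) (g : ℕ × ℕ → ℝ≥0∞) (k : ℕ) (i : ι) :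
    ∑' z, rate (tandem num lam mu1 mu2 m).generator (k, i) z * g (z.1, num z.2) =
      (if (num i : ℕ∞) < m then ENNReal.ofReal lam * g (k, num i + 1) else 0) +
      (if 0 < num i then ENNReal.ofReal mu1 * g (k + 1, num i - 1) else 0) +
      (if 0 < k then ENNReal.ofReal mu2 * g (k - 1, num i) else 0) := by
  simp only [tandem_rate hinj, add_mul, ENNReal.tsum_add]
  have hlt : (num i : ℕ∞) < m ↔ ((num i + 1 : ℕ) : ℕ∞) ≤ m := by
    rw [Nat.cast_add, Nat.cast_one, ENat.add_one_le_iff (ENat.natCast_ne_top _)]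
  have hsub : ∀ n : ℕ, n ≤ num i → ∃ j, num j = n := fun n hn =>
    (hnum n).1 (le_trans (by exact_mod_cast hn) ((hnum (num i)).2 ⟨i, rfl⟩))
  congr 1
  · congr 1
    · split_ifs with h
      · exact tsum_ite_mul hinj _ g _ _ ((hnum _).1 (hlt.1 h))
      · refine ENNReal.tsum_eq_zero.2 fun z => ?_
        rw [if_neg, zero_mul]
        rintro ⟨-, h2⟩
        exact h (hlt.2 ((hnum _).2 ⟨_, h2⟩))
    · split_ifs with h
      · rw [← tsum_ite_mul hinj _ g _ _ (hsub (num i - 1) (by omega))]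
        refine tsum_congr fun z => ?_
        congr 2
        refine propext (and_congr_right fun _ => ?_)
        omega
      · refine ENNReal.tsum_eq_zero.2 fun z => ?_
        rw [if_neg, zero_mul]
        omega
  · split_ifs with h
    · rw [← tsum_ite_mul hinj _ g _ _ (hsub (num i) le_rfl)]
      refine tsum_congr fun z => ?_
      congr 2
      refine propext (and_congr_left fun _ => ?_)
      omega
    · refine ENNReal.tsum_eq_zero.2 fun z => ?_
      rw [if_neg, zero_mul]
      omega

/-- The total intensity out of phase `n` of the first queue. -/
def outRate (lam mu1 : ℝ) (m : ℕ∞) (n : ℕ) : ℝ :=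
  (if (n : ℕ∞) < m then lam else 0) + (if 0 < n then mu1 else 0)

section Rates

lemma tandem_exitRate
    (hinj : Function.Injective num) (hnum : ∀ n : ℕ, (n : ℕ∞) ≤ m ↔ ∃ i, num i = n)
    (hlam : 0 < lam) (hmu1 : 0 < mu1) (hmu2 : 0 < mu2) (k : ℕ) (i : ι) :
    exitRate (tandem num lam mu1 mu2 m).generator (k, i) =
      ENNReal.ofReal (outRate lam mu1 m (num i) + (if 0 < k then mu2 else 0)) := by
  have h := tandem_tsum_rate (lam := lam) (mu1 := mu1) (mu2 := mu2) hinj hnum (fun _ => 1) k i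
  simp only [mul_one] at h
  rw [exitRate, h, outRate, ENNReal.ofReal_add (by positivity) (by positivity),
    ENNReal.ofReal_add (by positivity) (by positivity)]
  simp only [apply_ite ENNReal.ofReal, ENNReal.ofReal_zero]

lemma tandem_exitRate_ne_top
    (hinj : Function.Injective num) (hnum : ∀ n : ℕ, (n : ℕ∞) ≤ m ↔ ∃ i, num i = n)
    (hlam : 0 < lam) (hmu1 : 0 < mu1) (hmu2 : 0 < mu2) (x : ℕ × ι) :
    exitRate (tandem num lam mu1 mu2 m).generator x ≠ ∞ := by
  obtain ⟨k, i⟩ := x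
  rw [tandem_exitRate hinj hnum hlam hmu1 hmu2]
  exact ENNReal.ofReal_ne_top

lemma tandem_exitRate_ne_zero
    (hinj : Function.Injective num) (hnum : ∀ n : ℕ, (n : ℕ∞) ≤ m ↔ ∃ i, num i = n)
    (hlam : 0 < lam) (hmu1 : 0 < mu1) (hmu2 : 0 < mu2) (hm : 1 ≤ m)
    (x : ℕ × ι) : exitRate (tandem num lam mu1 mu2 m).generator x ≠ 0 := by
  obtain ⟨k, i⟩ := x
  rw [tandem_exitRate hinj hnum hlam hmu1 hmu2, outRate]
  have h2 : 0 ≤ (if 0 < k then mu2 else 0) := by positivity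
  by_cases h : (num i : ℕ∞) < m
  · have h1 : 0 ≤ (if 0 < num i then mu1 else 0) := by positivity
    rw [if_pos h]
    exact (ENNReal.ofReal_pos.2 (by linarith)).ne'
  · have hi : 0 < num i := by
      have := hm.trans (not_lt.1 h)
      exact_mod_cast this
    rw [if_neg h, if_pos hi]
    exact (ENNReal.ofReal_pos.2 (by linarith)).ne'

/-- A nonnegative supersolution G dominates the expected value of G on arrival at level K. The
inequality is required at all positive levels, also above K, since the set off the two levels
contains those. -/
lemma tandem_tsum_hit_le
    (hinj : Function.Injective num) (hnum : ∀ n : ℕ, (n : ℕ∞) ≤ m ↔ ∃ i, num i = n)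
    (hlam : 0 < lam) (hmu1 : 0 < mu1) (hmu2 : 0 < mu2) (hm : 1 ≤ m)
    (G : ℕ → ℕ → ℝ) (hG : ∀ k n, 0 ≤ G k n)
    (hsup : ∀ k n : ℕ, 0 < k → (n : ℕ∞) ≤ m →
      (if (n : ℕ∞) < m then lam * G k (n + 1) else 0) +
        (if 0 < n then mu1 * G (k + 1) (n - 1) else 0) + mu2 * G (k - 1) n
      ≤ (outRate lam mu1 m n + mu2) * G k n) (K k : ℕ) (i : ι) :
    ∑' l, (tandem num lam mu1 mu2 m).hit K (k, i) l * ENNReal.ofReal (G K (num l))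
      ≤ ENNReal.ofReal (G k (num i)) := by
  have h0 := tandem_exitRate_ne_zero hinj hnum hlam hmu1 hmu2 hm
  have h1 := tandem_exitRate_ne_top hinj hnum hlam hmu1 hmu2
  rw [← QBD.exitVal_level]
  refine exitVal_le_of_rate (g := fun z => ENNReal.ofReal (G z.1 (num z.2))) h0 h1 ?_ ?_ (k, i)
  · rintro ⟨l, j⟩ -
    simp only
    split_ifs with h
    · rw [h]
    · exact zero_le
  · rintro ⟨l, j⟩ hl
    have hl0 : 0 < l := Nat.pos_of_ne_zero hl.1
    have hout : 0 ≤ outRate lam mu1 m (num j) := by unfold outRate; positivity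
    have hs := hsup l (num j) hl0 ((hnum _).2 ⟨j, rfl⟩)
    have h := tandem_tsum_rate (lam := lam) (mu1 := mu1) (mu2 := mu2) hinj hnum
      (fun z => ENNReal.ofReal (G z.1 z.2)) l j
    simp only at h ⊢
    rw [h, tandem_exitRate hinj hnum hlam hmu1 hmu2, if_pos hl0, if_pos hl0,
      ← ENNReal.ofReal_mul (p := outRate lam mu1 m (num j) + mu2) (by positivity)]
    refine le_trans (le_of_eq ?_) (ENNReal.ofReal_le_ofReal hs)
    have e1 := mul_nonneg hlam.le (hG l (num j + 1))
    have e2 := mul_nonneg hmu1.le (hG (l + 1) (num j - 1))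
    have e3 := mul_nonneg hmu2.le (hG (l - 1) (num j))
    rw [ENNReal.ofReal_add (by positivity) e3, ENNReal.ofReal_add (by positivity) (by positivity)]
    simp only [apply_ite ENNReal.ofReal, ENNReal.ofReal_zero, ENNReal.ofReal_mul hlam.le,
      ENNReal.ofReal_mul hmu1.le, ENNReal.ofReal_mul hmu2.le]

lemma tandem_hitProb_mul_le
    (hinj : Function.Injective num) (hnum : ∀ n : ℕ, (n : ℕ∞) ≤ m ↔ ∃ i, num i = n)
    [Countable ι] [MeasurableSpace ι] [MeasurableSingletonClass ι]
    (hlam : 0 < lam) (hmu1 : 0 < mu1) (hmu2 : 0 < mu2) (hm : 1 ≤ m)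
    (G : ℕ → ℕ → ℝ) (hG : ∀ k n, 0 ≤ G k n)
    (hsup : ∀ k n : ℕ, 0 < k → (n : ℕ∞) ≤ m →
      (if (n : ℕ∞) < m then lam * G k (n + 1) else 0) +
        (if 0 < n then mu1 * G (k + 1) (n - 1) else 0) + mu2 * G (k - 1) n
      ≤ (outRate lam mu1 m n + mu2) * G k n) (K k : ℕ) (i j : ι) :
    (tandem num lam mu1 mu2 m).hitProb k K i j * G K (num j) ≤ G k (num i) := by
  rw [QBD.hitProb_eq_hit (tandem_exitRate_ne_zero hinj hnum hlam hmu1 hmu2 hm)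
    (tandem_exitRate_ne_top hinj hnum hlam hmu1 hmu2)]
  have h := (ENNReal.le_tsum j).trans
    (tandem_tsum_hit_le hinj hnum hlam hmu1 hmu2 hm G hG hsup K k i)
  have h' := ENNReal.toReal_mono ENNReal.ofReal_ne_top h
  rwa [ENNReal.toReal_mul, ENNReal.toReal_ofReal (hG _ _), ENNReal.toReal_ofReal (hG _ _)] at h'

lemma tandem_sum_hitProb_mul_le
    (hinj : Function.Injective num) (hnum : ∀ n : ℕ, (n : ℕ∞) ≤ m ↔ ∃ i, num i = n)
    [Fintype ι] [MeasurableSpace ι] [MeasurableSingletonClass ι]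
    (hlam : 0 < lam) (hmu1 : 0 < mu1) (hmu2 : 0 < mu2) (hm : 1 ≤ m)
    (G : ℕ → ℕ → ℝ) (hG : ∀ k n, 0 ≤ G k n)
    (hsup : ∀ k n : ℕ, 0 < k → (n : ℕ∞) ≤ m →
      (if (n : ℕ∞) < m then lam * G k (n + 1) else 0) +
        (if 0 < n then mu1 * G (k + 1) (n - 1) else 0) + mu2 * G (k - 1) n
      ≤ (outRate lam mu1 m n + mu2) * G k n) (K k : ℕ) (i : ι) :
    ∑ j, (tandem num lam mu1 mu2 m).hitProb k K i j * G K (num j) ≤ G k (num i) := by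
  simp only [QBD.hitProb_eq_hit (tandem_exitRate_ne_zero hinj hnum hlam hmu1 hmu2 hm)
    (tandem_exitRate_ne_top hinj hnum hlam hmu1 hmu2)]
  have h := tandem_tsum_hit_le hinj hnum hlam hmu1 hmu2 hm G hG hsup K k i
  rw [tsum_fintype] at h
  have h' := ENNReal.toReal_mono ENNReal.ofReal_ne_top h
  rw [ENNReal.toReal_sum fun l _ =>
    ENNReal.mul_ne_top (QBD.hit_ne_top _ _ _) ENNReal.ofReal_ne_top] at h'
  simpa only [ENNReal.toReal_mul, ENNReal.toReal_ofReal (hG _ _)] using h'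

lemma tandem_hit_ne_zero_of_step
    (hinj : Function.Injective num) (hnum : ∀ n : ℕ, (n : ℕ∞) ≤ m ↔ ∃ i, num i = n)
    (hlam : 0 < lam) (hmu1 : 0 < mu1) (hmu2 : 0 < mu2) (hm : 1 ≤ m)
    {K k : ℕ} {i : ι} {z : ℕ × ι} (hk : k ≠ 0) (hkK : k ≠ K)
    (hz : (z.1 = k ∧ num z.2 = num i + 1) ∨ (z.1 = k + 1 ∧ num z.2 + 1 = num i) ∨
      (z.1 + 1 = k ∧ num z.2 = num i)) {j : ι}
    (h : (tandem num lam mu1 mu2 m).hit K z j ≠ 0) :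
    (tandem num lam mu1 mu2 m).hit K (k, i) j ≠ 0 := by
  have h0 := tandem_exitRate_ne_zero hinj hnum hlam hmu1 hmu2 hm
  have h1 := tandem_exitRate_ne_top hinj hnum hlam hmu1 hmu2
  rw [QBD.hit, exitVal_of_mem (C := offLevels ι K) ⟨hk, hkK⟩]
  intro hzero
  have := ENNReal.tsum_eq_zero.1 hzero z
  rw [jumpPMF_eq (h0 _) (h1 _), tandem_rate hinj, mul_eq_zero, mul_eq_zero,
    ENNReal.inv_eq_zero] at this
  rcases this with (hr | hr) | hr
  · rw [add_eq_zero, add_eq_zero] at hr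
    obtain ⟨⟨ha, hb⟩, hc⟩ := hr
    rcases hz with hz | hz | hz
    · rw [if_pos hz] at ha; simp [hlam.not_ge] at ha
    · rw [if_pos hz] at hb; simp [hmu1.not_ge] at hb
    · rw [if_pos hz] at hc; simp [hmu2.not_ge] at hc
  · exact h1 _ hr
  · exact h hr

/-- Arrivals fill the first queue to one more than the target phase, which is possible as the target
is below capacity; a single transfer then reaches the next level. -/
lemma tandem_hit_succ_ne_zero_of_le
    (hinj : Function.Injective num) (hnum : ∀ n : ℕ, (n : ℕ∞) ≤ m ↔ ∃ i, num i = n)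
    (hlam : 0 < lam) (hmu1 : 0 < mu1) (hmu2 : 0 < mu2)
    (hm : 1 ≤ m) {k : ℕ} (hk : k ≠ 0) {i j : ι} (hj : (num j : ℕ∞) < m)
    (hij : num i ≤ num j + 1) : (tandem num lam mu1 mu2 m).hit (k + 1) (k, i) j ≠ 0 := by
  classical
  obtain ⟨d, hd⟩ := Nat.exists_eq_add_of_le hij
  induction d generalizing i with
  | zero =>
    refine tandem_hit_ne_zero_of_step hinj hnum hlam hmu1 hmu2 hm (z := (k + 1, j)) hk (by omega)
      (Or.inr (Or.inl ⟨rfl, by omega⟩)) ?_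
    rw [QBD.hit_top_level]
    simp
  | succ d ih =>
    obtain ⟨i', hi'⟩ := (hnum (num i + 1)).1
      (le_trans (by exact_mod_cast (by omega : num i + 1 ≤ num j + 1)) (Order.add_one_le_of_lt hj))
    exact tandem_hit_ne_zero_of_step hinj hnum hlam hmu1 hmu2 hm (z := (k, i')) hk (by omega)
      (Or.inl ⟨rfl, hi'⟩) (ih (by omega) (by omega))

/-- Too many customers in the first queue are removed one at a time by a departure from the second
queue followed by a transfer, which returns to level k. The detour visits level k - 1, which is not
0 only because k ≥ 2. -/
lemma tandem_hit_succ_ne_zero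
    (hinj : Function.Injective num) (hnum : ∀ n : ℕ, (n : ℕ∞) ≤ m ↔ ∃ i, num i = n)
    (hlam : 0 < lam) (hmu1 : 0 < mu1) (hmu2 : 0 < mu2)
    (hm : 1 ≤ m) {k : ℕ} (hk : 2 ≤ k) (i : ι) {j : ι} (hj : (num j : ℕ∞) < m) :
    (tandem num lam mu1 mu2 m).hit (k + 1) (k, i) j ≠ 0 := by
  rcases le_total (num i) (num j + 1) with hij | hij
  · exact tandem_hit_succ_ne_zero_of_le hinj hnum hlam hmu1 hmu2 hm (by omega) hj hij
  obtain ⟨d, hd⟩ := Nat.exists_eq_add_of_le hij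
  induction d generalizing i with
  | zero => exact tandem_hit_succ_ne_zero_of_le hinj hnum hlam hmu1 hmu2 hm (by omega) hj hd.le
  | succ d ih =>
    obtain ⟨i', hi'⟩ := (hnum (num i - 1)).1
      (le_trans (by exact_mod_cast (by omega : num i - 1 ≤ num i)) ((hnum _).2 ⟨i, rfl⟩))
    refine tandem_hit_ne_zero_of_step hinj hnum hlam hmu1 hmu2 hm (z := (k - 1, i)) (by omega)
      (by omega) (Or.inr (Or.inr ⟨by simp only; omega, rfl⟩)) ?_
    exact tandem_hit_ne_zero_of_step hinj hnum hlam hmu1 hmu2 hm (z := (k, i')) (by omega)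
      (by omega) (Or.inr (Or.inl ⟨by simp only; omega, by simp only [hi']; omega⟩))
      (ih i' (by omega) (by omega))

end Rates

end TandemRates

/-! ### Perron–Frobenius theory for nonnegative matrices -/

section Perron

variable {n : Type*} [Fintype n]

/-- Perron's theorem: a positive matrix has a positive eigenvector. -/
lemma exists_pos_eigenvector_of_pos [Nonempty n] (A : Matrix n n ℝ) (hA : ∀ i j, 0 < A i j) :
    ∃ (r : ℝ) (x : n → ℝ), 0 < r ∧ (∀ i, 0 < x i) ∧ A.mulVec x = r • x := by
  classical
  set T : ℝ := ∑ i, ∑ j, A i j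
  -- The Perron root is found as the largest r for which some x in the simplex satisfies r x ≤ A x;
  -- the bound T makes the set of such pairs compact.
  set s : Set (ℝ × (n → ℝ)) := (Set.Icc 0 T ×ˢ stdSimplex ℝ n) ∩
    {q | ∀ i, q.1 * q.2 i ≤ A.mulVec q.2 i} with hs
  have hcont : ∀ i, Continuous fun q : ℝ × (n → ℝ) => A.mulVec q.2 i := by
    intro i
    simp only [Matrix.mulVec, dotProduct]
    fun_prop
  have hcomp : IsCompact s := by
    refine (isCompact_Icc.prod (isCompact_stdSimplex ℝ n)).inter_right ?_
    have : {q : ℝ × (n → ℝ) | ∀ i, q.1 * q.2 i ≤ A.mulVec q.2 i}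
        = ⋂ i, {q | q.1 * q.2 i ≤ A.mulVec q.2 i} := by ext; simp
    rw [this]
    exact isClosed_iInter fun i => isClosed_le (by fun_prop) (hcont i)
  have hnonneg : ∀ x : n → ℝ, (∀ i, 0 ≤ x i) → ∀ i, 0 ≤ A.mulVec x i := fun x hx i =>
    Finset.sum_nonneg fun j _ => mul_nonneg (hA i j).le (hx j)
  have hpos : ∀ x : n → ℝ, (∀ i, 0 ≤ x i) → x ≠ 0 → ∀ i, 0 < A.mulVec x i := by
    intro x hx hx0 i
    obtain ⟨j, hj⟩ := Function.ne_iff.1 hx0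
    exact Finset.sum_pos' (fun j _ => mul_nonneg (hA i j).le (hx j))
      ⟨j, Finset.mem_univ _, mul_pos (hA i j) (lt_of_le_of_ne (hx j) (Ne.symm hj))⟩
  have hbound : ∀ (t : ℝ) (x : n → ℝ), x ∈ stdSimplex ℝ n → (∀ i, t * x i ≤ A.mulVec x i) →
      t ≤ T := by
    intro t x hx h
    calc t = ∑ i, t * x i := by rw [← Finset.mul_sum, hx.2, mul_one]
      _ ≤ ∑ i, A.mulVec x i := Finset.sum_le_sum fun i _ => h i
      _ ≤ T := by
        refine Finset.sum_le_sum fun i _ => Finset.sum_le_sum fun j _ => ?_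
        have : x j ≤ 1 := hx.2 ▸ Finset.single_le_sum (fun k _ => hx.1 k) (Finset.mem_univ j)
        exact mul_le_of_le_one_right (hA i j).le this
  have hne : s.Nonempty := by
    obtain ⟨i⟩ := ‹Nonempty n›
    refine ⟨(0, Pi.single i 1), ⟨⟨le_rfl, ?_⟩, single_mem_stdSimplex ℝ i⟩, ?_⟩
    · exact Finset.sum_nonneg fun i _ => Finset.sum_nonneg fun j _ => (hA i j).le
    · intro k
      simp only [zero_mul]
      exact hnonneg _ (single_mem_stdSimplex ℝ i).1 k
  obtain ⟨⟨r, x⟩, ⟨⟨⟨hr0, -⟩, hx⟩, hle⟩, hmax⟩ := hcomp.exists_isMaxOn hne continuous_fst.continuousOn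
  simp only at hr0 hx hle
  have hx0 : x ≠ 0 := by
    rintro rfl
    have := hx.2
    simp at this
  set y := A.mulVec x with hy
  have hypos : ∀ i, 0 < y i := hpos x hx.1 hx0
  -- Otherwise A maps the nonzero nonnegative vector y - r x to a strictly positive one. Then y,
  -- after normalisation, admits a factor larger than r, against maximality.
  have heq : y = r • x := by
    by_contra hcon
    have hd : y - r • x ≠ 0 := sub_ne_zero.2 hcon
    have hAd := hpos (y - r • x) (fun i => by simpa using hle i) hd
    have hAd' : ∀ i, r * y i < A.mulVec y i := by
      intro i
      have := hAd i
      rw [Matrix.mulVec_sub, Matrix.mulVec_smul, ← hy] at this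
      simpa using this
    obtain ⟨i0, hi0⟩ := Finite.exists_min fun i => A.mulVec y i / y i
    set t := A.mulVec y i0 / y i0
    have hrt : r < t := (lt_div_iff₀ (hypos i0)).2 (hAd' i0)
    have ht : ∀ i, t * y i ≤ A.mulVec y i := fun i => (le_div_iff₀ (hypos i)).1 (hi0 i)
    set σ := ∑ i, y i
    have hσ : 0 < σ := Finset.sum_pos (fun i _ => hypos i) Finset.univ_nonempty
    have hmem : σ⁻¹ • y ∈ stdSimplex ℝ n := by
      refine ⟨fun i => mul_nonneg (inv_nonneg.2 hσ.le) (hypos i).le, ?_⟩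
      simp only [Pi.smul_apply, smul_eq_mul]
      rw [← Finset.mul_sum, inv_mul_cancel₀ hσ.ne']
    have hle' : ∀ i, t * (σ⁻¹ • y) i ≤ A.mulVec (σ⁻¹ • y) i := by
      intro i
      rw [Matrix.mulVec_smul]
      simp only [Pi.smul_apply, smul_eq_mul]
      rw [mul_left_comm]
      exact mul_le_mul_of_nonneg_left (ht i) (inv_nonneg.2 hσ.le)
    have : t ≤ r := hmax (a := (t, σ⁻¹ • y))
      ⟨⟨⟨hr0.trans hrt.le, hbound t _ hmem hle'⟩, hmem⟩, hle'⟩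
    exact absurd hrt (not_lt.2 this)
  have hrx : ∀ i, 0 < r * x i := fun i => by
    have := hypos i
    rwa [heq] at this
  obtain ⟨i⟩ := ‹Nonempty n›
  have hr : 0 < r := pos_of_mul_pos_left (hrx i) (hx.1 i)
  exact ⟨r, x, hr, fun i => pos_of_mul_pos_right (hrx i) hr.le, heq⟩

/-- Perron's theorem for a matrix some of whose columns vanish, the others being positive. -/
lemma exists_pos_eigenvector (A : Matrix n n ℝ) (p : n → Prop) (hp : ∃ j, p j)
    (hA : ∀ i j, p j → 0 < A i j) (hA0 : ∀ i j, ¬ p j → A i j = 0) :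
    ∃ (r : ℝ) (v : n → ℝ), 0 < r ∧ (∀ i, 0 < v i) ∧ A.mulVec v = r • v := by
  classical
  have : Nonempty {j // p j} := let ⟨j, hj⟩ := hp; ⟨⟨j, hj⟩⟩
  obtain ⟨r, x, hr, hx, hAx⟩ := exists_pos_eigenvector_of_pos
    (A.submatrix (Subtype.val : {j // p j} → n) Subtype.val) (fun i j => hA _ _ j.2)
  have hsum : ∀ (i : n) (w : n → ℝ), ∑ j, A i j * w j = ∑ j : {j // p j}, A i j * w j := by
    intro i w
    have h := Finset.sum_subtype (p := p) (F := inferInstance) (Finset.univ.filter p) (by simp) (fun j => A i j * w j)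
    refine Eq.trans ?_ h
    rw [Finset.sum_filter]
    refine Finset.sum_congr rfl fun j _ => ?_
    split_ifs with h
    · rfl
    · rw [hA0 i j h, zero_mul]
  -- The eigenvector of the positive block is extended to the other coordinates by applying A once.
  set u : n → ℝ := fun i => ∑ j : {j // p j}, A i j * x j
  have hu : ∀ i : {j // p j}, u i = r * x i := fun i => congrFun hAx i
  refine ⟨r, u, hr, fun i => Finset.sum_pos (fun j _ => mul_pos (hA _ _ j.2) (hx j))
    Finset.univ_nonempty, ?_⟩
  ext i
  rw [Matrix.mulVec, dotProduct, hsum]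
  simp only [hu, Pi.smul_apply, smul_eq_mul, u]
  rw [Finset.mul_sum]
  exact Finset.sum_congr rfl fun j _ => by ring

/-- A positive eigenvector v dominates all eigenvalues: for a complex eigenvector u, evaluate the
eigenvalue equation at an index maximising |u i| / v i. -/
lemma isMaximalEigenvalue_of_pos [DecidableEq n] [Nonempty n] {A : Matrix n n ℝ}
    (hA : ∀ i j, 0 ≤ A i j) {h : ℝ} {v : n → ℝ} (hv : ∀ i, 0 < v i) (hAv : A.mulVec v = h • v) :
    IsMaximalEigenvalue A h := by
  obtain ⟨i₀⟩ := ‹Nonempty n›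
  refine ⟨Module.End.hasEigenvalue_of_hasEigenvector (x := v) ⟨?_, ?_⟩, fun z hz => ?_⟩
  · rw [Module.End.mem_eigenspace_iff, Matrix.toLin'_apply, hAv]
  · intro h0
    exact (hv i₀).ne' (congrFun h0 i₀)
  · obtain ⟨u, hu⟩ := hz.exists_hasEigenvector
    have hu1 := hu.apply_eq_smul
    rw [Matrix.toLin'_apply] at hu1
    have : Nonempty n := ⟨i₀⟩
    obtain ⟨i, hi⟩ := Finite.exists_max fun i => ‖u i‖ / v i
    set M := ‖u i‖ / v i
    have hM : ∀ j, ‖u j‖ ≤ M * v j := fun j => (div_le_iff₀ (hv j)).1 (hi j)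
    have hMi : ‖u i‖ = M * v i := (div_mul_cancel₀ _ (hv i).ne').symm
    have hui : 0 < ‖u i‖ := by
      by_contra hcon
      have h0 : ‖u i‖ = 0 := le_antisymm (not_lt.1 hcon) (norm_nonneg _)
      have hM0 : M = 0 := by simp [M, h0]
      refine hu.2 (funext fun j => ?_)
      have := hM j
      rw [hM0, zero_mul] at this
      simpa using this
    have hAvi : ∑ j, A i j * v j = h * v i := congrFun hAv i
    have key : ‖z‖ * ‖u i‖ ≤ h * ‖u i‖ := by
      calc ‖z‖ * ‖u i‖ = ‖(z • u) i‖ := by simp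
        _ = ‖∑ j, (A i j : ℂ) * u j‖ := by rw [← hu1]; rfl
        _ ≤ ∑ j, ‖(A i j : ℂ) * u j‖ := norm_sum_le _ _
        _ ≤ ∑ j, M * (A i j * v j) := by
          refine Finset.sum_le_sum fun j _ => ?_
          rw [norm_mul, Complex.norm_real, Real.norm_of_nonneg (hA i j)]
          calc A i j * ‖u j‖ ≤ A i j * (M * v j) := mul_le_mul_of_nonneg_left (hM j) (hA i j)
            _ = _ := by ring
        _ = h * ‖u i‖ := by rw [← Finset.mul_sum, hAvi, hMi]; ring
    exact le_of_mul_le_mul_right key hui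

end Perron

/-! ### From exponential bounds to logarithmic limits -/

section LogAsymptotics

/-- Exponential upper and lower bounds determine the logarithmic decay rate. -/
lemma tendsto_log_div_of_bounds {a : ℕ → ℝ} {r C : ℝ} (hr : 0 < r) (hC : 0 < C)
    (hup : ∀ᶠ K in atTop, a K ≤ C * r ^ K)
    (hlow : ∀ s, 0 < s → s < r → ∃ c, 0 < c ∧ ∀ᶠ K in atTop, c * s ^ K ≤ a K) :
    Tendsto (fun K : ℕ => Real.log (a K) / (K : ℝ)) atTop (𝓝 (Real.log r)) := by
  have hlim : ∀ c s : ℝ, Tendsto (fun K : ℕ => Real.log c / (K : ℝ) + Real.log s) atTop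
      (𝓝 (Real.log s)) := fun c s => by
    simpa using (tendsto_const_div_atTop_nhds_zero_nat (Real.log c)).add_const (Real.log s)
  have hform : ∀ (c s : ℝ) (K : ℕ), 0 < c → 0 < s → 0 < K →
      Real.log c / (K : ℝ) + Real.log s = Real.log (c * s ^ K) / K := by
    intro c s K hc hs hK
    have hK' : (K : ℝ) ≠ 0 := by exact_mod_cast hK.ne'
    rw [Real.log_mul hc.ne' (pow_pos hs K).ne', Real.log_pow]
    field_simp
  refine tendsto_order.2 ⟨fun y hy => ?_, fun y hy => ?_⟩
  · obtain ⟨y', hy1, hy2⟩ := exists_between hy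
    have hs : Real.exp y' < r := by
      rw [← Real.exp_log hr]; exact Real.exp_lt_exp.2 hy2
    obtain ⟨c, hc, hev⟩ := hlow _ (Real.exp_pos y') hs
    have h1 := (hlim c (Real.exp y')).eventually_const_lt (by rwa [Real.log_exp])
    filter_upwards [h1, hev, eventually_gt_atTop 0] with K hK1 hK2 hK
    refine hK1.trans_le ?_
    rw [hform _ _ K hc (Real.exp_pos y') hK]
    gcongr
  · have h1 := (hlim C r).eventually_lt_const hy
    -- The lower bound is used here only to make a K positive, so that the logarithm is monotone.
    obtain ⟨c, hc, hev⟩ := hlow (r / 2) (by positivity) (by linarith)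
    filter_upwards [h1, hup, hev, eventually_gt_atTop 0] with K hK1 hK2 hK3 hK
    refine lt_of_le_of_lt ?_ hK1
    have : 0 < a K := lt_of_lt_of_le (by positivity) hK3
    rw [hform _ _ K hC hr hK]
    gcongr

end LogAsymptotics

/-! ### The matrix H and the decay rate as its Perron root -/

section Finite

variable {ι : Type*} {num : ι → ℕ} {lam mu1 mu2 : ℝ} {m : ℕ∞}

section Rates

/-- Level K is entered by a transfer, after which the first queue cannot be full. The dominating
function is 1 at the forbidden state and at levels above K, and 0 elsewhere; below K no jump leads
to its support. -/
lemma tandem_hit_eq_zero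
    (hinj : Function.Injective num) (hnum : ∀ n : ℕ, (n : ℕ∞) ≤ m ↔ ∃ i, num i = n)
    (hlam : 0 < lam) (hmu1 : 0 < mu1) (hmu2 : 0 < mu2) (hm : 1 ≤ m)
    {K k : ℕ} (hk : k < K) (i : ι) {j : ι} (hj : ¬ (num j : ℕ∞) < m) :
    (tandem num lam mu1 mu2 m).hit K (k, i) j = 0 := by
  classical
  have h0 := tandem_exitRate_ne_zero hinj hnum hlam hmu1 hmu2 hm
  have h1 := tandem_exitRate_ne_top hinj hnum hlam hmu1 hmu2
  have hle := exitVal_le (Q := (tandem num lam mu1 mu2 m).generator) (C := offLevels ι K)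
    (b := Set.indicator {(K, j)} 1) (g := fun x => if x = (K, j) ∨ K < x.1 then 1 else 0)
    (fun x _ => by
      by_cases hx : x = (K, j)
      · simp [hx]
      · rw [Set.indicator_of_notMem (by simpa using hx)]; exact zero_le)
    (fun x hx => by
      obtain ⟨l, i'⟩ := x
      by_cases hl : K < l
      · rw [if_pos (Or.inr hl), ← PMF.tsum_coe (jumpPMF (tandem num lam mu1 mu2 m).generator (l, i'))]
        refine ENNReal.tsum_le_tsum fun z => ?_
        split_ifs <;> simp
      · refine le_of_eq_of_le (ENNReal.tsum_eq_zero.2 fun z => ?_) zero_le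
        have hlK : l ≠ K := hx.2
        split_ifs with hz
        · rw [jumpPMF_eq (h0 _) (h1 _)]
          rcases hz with rfl | hz
          · rw [tandem_rate hinj]
            have hnj : ¬ num j + 1 = num i' := fun h => hj <| by
              have := (hnum (num j + 1)).2 ⟨i', h.symm⟩
              rw [Nat.cast_add, Nat.cast_one, ENat.add_one_le_iff (ENat.natCast_ne_top _)] at this
              exact this
            rw [if_neg (by simp only; omega), if_neg (by simp only; omega),
              if_neg (by simp only; omega)]
            simp
          · rw [QBD.rate_eq_zero (by simp only; omega)]; simp
        · simp)
    (k, i)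
  rw [if_neg] at hle
  · exact le_antisymm hle zero_le
  · simp only [Prod.mk.injEq]
    omega

variable [Fintype ι] [MeasurableSpace ι] [MeasurableSingletonClass ι]

lemma tandem_H_pos
    (hinj : Function.Injective num) (hnum : ∀ n : ℕ, (n : ℕ∞) ≤ m ↔ ∃ i, num i = n)
    (hlam : 0 < lam) (hmu1 : 0 < mu1) (hmu2 : 0 < mu2) (hm : 1 ≤ m)
    (i : ι) {j : ι} (hj : (num j : ℕ∞) < m) : 0 < (tandem num lam mu1 mu2 m).H i j := by
  have h0 := tandem_exitRate_ne_zero hinj hnum hlam hmu1 hmu2 hm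
  have h1 := tandem_exitRate_ne_top hinj hnum hlam hmu1 hmu2
  refine lt_of_lt_of_le ?_ (QBD.hitProb_le_H h0 h1 2 i j)
  rw [QBD.hitProb_eq_hit h0 h1]
  exact ENNReal.toReal_pos (tandem_hit_succ_ne_zero hinj hnum hlam hmu1 hmu2 hm le_rfl i hj)
    (QBD.hit_ne_top _ _ _)

lemma tandem_H_eq_zero
    (hinj : Function.Injective num) (hnum : ∀ n : ℕ, (n : ℕ∞) ≤ m ↔ ∃ i, num i = n)
    (hlam : 0 < lam) (hmu1 : 0 < mu1) (hmu2 : 0 < mu2) (hm : 1 ≤ m)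
    (i : ι) {j : ι} (hj : ¬ (num j : ℕ∞) < m) : (tandem num lam mu1 mu2 m).H i j = 0 := by
  have h0 := tandem_exitRate_ne_zero hinj hnum hlam hmu1 hmu2 hm
  have h1 := tandem_exitRate_ne_top hinj hnum hlam hmu1 hmu2
  simp only [QBD.H, QBD.hitProb_eq_hit h0 h1,
    tandem_hit_eq_zero hinj hnum hlam hmu1 hmu2 hm (Nat.lt_succ_self _) i hj]
  simp

lemma tandem_hitProb_nonneg
    (hinj : Function.Injective num) (hnum : ∀ n : ℕ, (n : ℕ∞) ≤ m ↔ ∃ i, num i = n)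
    (hlam : 0 < lam) (hmu1 : 0 < mu1) (hmu2 : 0 < mu2) (hm : 1 ≤ m)
    (k K : ℕ) (i j : ι) : 0 ≤ (tandem num lam mu1 mu2 m).hitProb k K i j := by
  rw [QBD.hitProb_eq_hit (tandem_exitRate_ne_zero hinj hnum hlam hmu1 hmu2 hm)
    (tandem_exitRate_ne_top hinj hnum hlam hmu1 hmu2)]
  exact ENNReal.toReal_nonneg

lemma tandem_sum_hitProb_pos
    (hinj : Function.Injective num) (hnum : ∀ n : ℕ, (n : ℕ∞) ≤ m ↔ ∃ i, num i = n)
    (hlam : 0 < lam) (hmu1 : 0 < mu1) (hmu2 : 0 < mu2) (hm : 1 ≤ m)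
    {v : ι → ℝ} (hv : ∀ i, 0 < v i) (i : ι) {K : ℕ} (hK : 2 ≤ K) :
    0 < ∑ j, (tandem num lam mu1 mu2 m).hitProb 1 K i j * v j := by
  have h0 := tandem_exitRate_ne_zero hinj hnum hlam hmu1 hmu2 hm
  have h1 := tandem_exitRate_ne_top hinj hnum hlam hmu1 hmu2
  have hnn := tandem_hitProb_nonneg hinj hnum hlam hmu1 hmu2 hm
  suffices h : ∃ j, 0 < (tandem num lam mu1 mu2 m).hitProb 1 K i j by
    obtain ⟨j, hj⟩ := h
    exact Finset.sum_pos' (fun j _ => mul_nonneg (hnn _ _ _ _) (hv j).le)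
      ⟨j, Finset.mem_univ _, mul_pos hj (hv j)⟩
  induction K, hK using Nat.le_induction with
  | base =>
    -- Truncated subtraction covers an empty first queue as well: then j is also empty, and an
    -- arrival precedes the transfer.
    obtain ⟨j, hj⟩ := (hnum (num i - 1)).1
      (le_trans (by exact_mod_cast (by omega : num i - 1 ≤ num i)) ((hnum _).2 ⟨i, rfl⟩))
    have hjm : (num j : ℕ∞) < m := by
      rcases Nat.eq_zero_or_pos (num i) with h | h
      · rw [hj, h]
        exact lt_of_lt_of_le (by norm_num) hm
      · have h' := (hnum _).2 ⟨i, rfl⟩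
        exact lt_of_lt_of_le (by exact_mod_cast (by omega : num j < num i)) h'
    refine ⟨j, ?_⟩
    rw [QBD.hitProb_eq_hit h0 h1]
    exact ENNReal.toReal_pos (tandem_hit_succ_ne_zero_of_le hinj hnum hlam hmu1 hmu2 hm
      one_ne_zero hjm (by omega)) (QBD.hit_ne_top _ _ _)
  | succ K hK ih =>
    obtain ⟨l, hl⟩ := ih
    obtain ⟨j, hj⟩ := (hnum 0).1 (by simp)
    have hjm : (num j : ℕ∞) < m := by rw [hj]; exact lt_of_lt_of_le (by norm_num) hm
    refine ⟨j, ?_⟩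
    rw [QBD.hitProb_succ h0 h1 (by omega)]
    refine Finset.sum_pos' (fun l _ => mul_nonneg (hnn _ _ _ _) (hnn _ _ _ _))
      ⟨l, Finset.mem_univ _, mul_pos hl ?_⟩
    rw [QBD.hitProb_eq_hit h0 h1]
    exact ENNReal.toReal_pos (tandem_hit_succ_ne_zero hinj hnum hlam hmu1 hmu2 hm hK l hjm)
      (QBD.hit_ne_top _ _ _)

/-- All estimates are made for the row P_1^K paired with the eigenvector v. Replacing a one-level
factor by H multiplies this pairing by exactly h, so bounding the factors by H and by qH gives
geometric growth with ratios h and qh. -/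
lemma tandem_tendsto_log_hitProb
    (hinj : Function.Injective num) (hnum : ∀ n : ℕ, (n : ℕ∞) ≤ m ↔ ∃ i, num i = n)
    (hlam : 0 < lam) (hmu1 : 0 < mu1) (hmu2 : 0 < mu2) (hm : 1 ≤ m)
    {h : ℝ} (hh : 0 < h) {v : ι → ℝ} (hv : ∀ i, 0 < v i)
    (hHv : (tandem num lam mu1 mu2 m).H.mulVec v = h • v) (i : ι) {j : ι}
    (hj : (num j : ℕ∞) < m) :
    Tendsto (fun K : ℕ => Real.log ((tandem num lam mu1 mu2 m).hitProb 1 K i j) / (K : ℝ))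
      atTop (𝓝 (Real.log h)) := by
  classical
  have h0 := tandem_exitRate_ne_zero hinj hnum hlam hmu1 hmu2 hm
  have h1 := tandem_exitRate_ne_top hinj hnum hlam hmu1 hmu2
  have hnn := tandem_hitProb_nonneg hinj hnum hlam hmu1 hmu2 hm
  set B := tandem num lam mu1 mu2 m
  have hHv' : ∀ l, ∑ j, B.H l j * v j = h * v l := fun l => congrFun hHv l
  have hstep : ∀ K, 1 ≤ K → ∑ j, B.hitProb 1 (K + 1) i j * v j
      = ∑ l, B.hitProb 1 K i l * ∑ j, B.hitProb K (K + 1) l j * v j := by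
    intro K hK
    simp only [QBD.hitProb_succ h0 h1 hK, Finset.sum_mul, Finset.mul_sum]
    rw [Finset.sum_comm]
    simp only [mul_assoc]
  have hup : ∀ K, 1 ≤ K → ∑ j, B.hitProb 1 K i j * v j ≤ v i / h * h ^ K := by
    intro K hK
    induction K, hK using Nat.le_induction with
    | base =>
      simp only [QBD.hitProb_eq_hit h0 h1, QBD.hit_top_level]
      rw [Finset.sum_eq_single i]
      · simp [div_mul_cancel₀ _ hh.ne']
      · intro l _ hl; simp [hl.symm]
      · simp
    | succ K hK ih =>
      calc _ ≤ ∑ l, B.hitProb 1 K i l * (h * v l) := by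
            rw [hstep K hK]
            refine Finset.sum_le_sum fun l _ => mul_le_mul_of_nonneg_left ?_ (hnn _ _ _ _)
            rw [← hHv']
            exact Finset.sum_le_sum fun j _ =>
              mul_le_mul_of_nonneg_right (QBD.hitProb_le_H h0 h1 K l j) (hv j).le
        _ = h * ∑ l, B.hitProb 1 K i l * v l := by
            rw [Finset.mul_sum]
            exact Finset.sum_congr rfl fun l _ => by ring
        _ ≤ h * (v i / h * h ^ K) := mul_le_mul_of_nonneg_left ih hh.le
        _ = _ := by ring
  refine tendsto_log_div_of_bounds hh (C := v i / h / v j) (by have := hv i; have := hv j; positivity)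
    ?_ fun s hs hsh => ?_
  · filter_upwards [eventually_ge_atTop 1] with K hK
    have h2 := hup K hK
    have h3 := Finset.single_le_sum (f := fun j => B.hitProb 1 K i j * v j)
      (fun l _ => mul_nonneg (hnn 1 K i l) (hv l).le) (Finset.mem_univ j)
    rw [div_mul_eq_mul_div, le_div_iff₀ (hv j)]
    exact h3.trans h2
  · set q := s / h with hq
    have hq0 : 0 < q := by positivity
    have hq1 : q < 1 := (div_lt_one hh).2 hsh
    have hqh : q * h = s := div_mul_cancel₀ _ hh.ne'
    -- Convergence gives this at entries where H is positive; at the zero column it is trivial.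
    -- Finitely many entries make the threshold uniform.
    have hev : ∀ᶠ k in atTop, ∀ l j, q * B.H l j ≤ B.hitProb k (k + 1) l j := by
      refine eventually_all.2 fun l => eventually_all.2 fun j => ?_
      by_cases hj : (num j : ℕ∞) < m
      · have hpos := tandem_H_pos hinj hnum hlam hmu1 hmu2 hm l hj
        exact ((QBD.tendsto_H h0 h1 l j).eventually_const_lt
          (mul_lt_of_lt_one_left hpos hq1)).mono fun k hk => hk.le
      · refine Eventually.of_forall fun k => ?_
        have : B.H l j = 0 := tandem_H_eq_zero hinj hnum hlam hmu1 hmu2 hm l hj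
        rw [this, mul_zero]
        exact hnn _ _ _ _
    obtain ⟨k1, hk1⟩ := eventually_atTop.1 hev
    set k0 := max k1 2
    have hk0 : ∀ k, k0 ≤ k → ∀ l j, q * B.H l j ≤ B.hitProb k (k + 1) l j := fun k hk =>
      hk1 k ((le_max_left _ _).trans hk)
    have h2k0 : 2 ≤ k0 := le_max_right _ _
    set c := ∑ j, B.hitProb 1 k0 i j * v j with hc
    have hcpos : 0 < c := tandem_sum_hitProb_pos hinj hnum hlam hmu1 hmu2 hm hv i h2k0
    have hlow : ∀ K, k0 ≤ K → c / s ^ k0 * s ^ K ≤ ∑ j, B.hitProb 1 K i j * v j := by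
      intro K hK
      induction K, hK using Nat.le_induction with
      | base => rw [div_mul_cancel₀ _ (pow_pos hs _).ne']
      | succ K hK ih =>
        calc _ = s * (c / s ^ k0 * s ^ K) := by ring
          _ ≤ s * ∑ j, B.hitProb 1 K i j * v j := mul_le_mul_of_nonneg_left ih hs.le
          _ = ∑ l, B.hitProb 1 K i l * ∑ j, q * B.H l j * v j := by
            rw [Finset.mul_sum]
            refine Finset.sum_congr rfl fun l _ => ?_
            simp only [mul_assoc]
            rw [← Finset.mul_sum, hHv', ← hqh]
            ring
          _ ≤ _ := by
            rw [hstep K (by omega)]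
            refine Finset.sum_le_sum fun l _ => mul_le_mul_of_nonneg_left ?_ (hnn _ _ _ _)
            exact Finset.sum_le_sum fun j _ => mul_le_mul_of_nonneg_right (hk0 K hK l j) (hv j).le
    have : Nonempty ι := ⟨i⟩
    -- To return from the pairing with v to the single entry j, one last level is climbed: column j
    -- of H is bounded below by δ v.
    obtain ⟨l0, hl0⟩ := Finite.exists_min fun l => B.H l j / v l
    set δ := B.H l0 j / v l0
    have hδ : 0 < δ := div_pos (tandem_H_pos hinj hnum hlam hmu1 hmu2 hm l0 hj) (hv l0)
    refine ⟨q * δ * (c / s ^ k0) / s, by positivity, ?_⟩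
    filter_upwards [eventually_ge_atTop (k0 + 1)] with K hK
    obtain ⟨K, rfl⟩ : ∃ K', K = K' + 1 := ⟨K - 1, by omega⟩
    rw [QBD.hitProb_succ h0 h1 (by omega)]
    calc _ = q * δ * (c / s ^ k0 * s ^ K) := by
          rw [pow_succ]
          field_simp
      _ ≤ q * δ * ∑ l, B.hitProb 1 K i l * v l :=
          mul_le_mul_of_nonneg_left (hlow K (by omega)) (by positivity)
      _ = ∑ l, B.hitProb 1 K i l * (q * (δ * v l)) := by
          rw [Finset.mul_sum]
          exact Finset.sum_congr rfl fun l _ => by ring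
      _ ≤ _ := by
          refine Finset.sum_le_sum fun l _ => mul_le_mul_of_nonneg_left ?_ (hnn _ _ _ _)
          refine le_trans (mul_le_mul_of_nonneg_left ?_ hq0.le) (hk0 K (by omega) l j)
          exact (le_div_iff₀ (hv l)).1 (hl0 l)

end Rates

end Finite

/-! ### Stability as negative drift of the level -/

section Drift

variable {lam mu1 mu2 : ℝ}

/-- A solution of the Poisson equation of the first queue, whose increments are
`1 - (1 - c / lam) * (1 + r + ⋯ + r ^ i)` with `r = mu1 / lam`. -/
def poissonSol (lam mu1 c : ℝ) (n : ℕ) : ℝ :=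
  ∑ i ∈ Finset.range n, (1 - (1 - c / lam) * ∑ l ∈ Finset.range (i + 1), (mu1 / lam) ^ l)

/-- With reward 1 per transfer, the increments are solved recursively and the equation holds in
phases below m for any c. The equation at the full queue closes the system precisely when c is the
throughput, which is `hc`. -/
lemma poissonSol_drift (hlam : 0 < lam) {m : ℕ} (hm : 1 ≤ m) {c : ℝ}
    (hc : c * ∑ l ∈ Finset.range (m + 1), (mu1 / lam) ^ l
      = lam * (mu1 / lam) * ∑ l ∈ Finset.range m, (mu1 / lam) ^ l) {n : ℕ} (hn : n ≤ m) :
    (if n < m then lam * (poissonSol lam mu1 c (n + 1) - poissonSol lam mu1 c n) else 0) +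
      (if 0 < n then mu1 * (poissonSol lam mu1 c (n - 1) - poissonSol lam mu1 c n + 1) else 0)
      = c := by
  have hsucc : ∀ n, poissonSol lam mu1 c (n + 1) - poissonSol lam mu1 c n
      = 1 - (1 - c / lam) * ∑ l ∈ Finset.range (n + 1), (mu1 / lam) ^ l := fun n => by
    rw [poissonSol, poissonSol, Finset.sum_range_succ]; ring
  rw [geom_sum_succ] at hc
  rcases n with _ | n
  · rw [if_pos (by omega), if_neg (by omega), hsucc]
    simp only [zero_add, Finset.sum_range_one, pow_zero]
    field_simp
    ring
  · have h2 : poissonSol lam mu1 c (n + 1 - 1) - poissonSol lam mu1 c (n + 1) + 1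
        = (1 - c / lam) * ∑ l ∈ Finset.range (n + 1), (mu1 / lam) ^ l := by
      rw [Nat.add_sub_cancel]
      linarith [hsucc n]
    rw [h2, hsucc, if_pos (Nat.succ_pos n), geom_sum_succ (n := n + 1)]
    set A := ∑ l ∈ Finset.range (n + 1), (mu1 / lam) ^ l with hA
    by_cases h : n + 1 < m
    · rw [if_pos h]
      field_simp
      ring
    · have hnm : m = n + 1 := by omega
      rw [if_neg h, zero_add]
      rw [hnm, ← hA] at hc
      field_simp at hc ⊢
      linarith

lemma pow_mul_geom_sum_inv {r : ℝ} (hr : r ≠ 0) (n : ℕ) :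
    r⁻¹ ^ n * ∑ l ∈ Finset.range (n + 1), r ^ l = ∑ l ∈ Finset.range (n + 1), r⁻¹ ^ l := by
  rw [Finset.mul_sum, ← Finset.sum_range_reflect]
  refine Finset.sum_congr rfl fun l hl => ?_
  rw [Finset.mem_range] at hl
  obtain ⟨d, rfl⟩ := Nat.exists_eq_add_of_le (Nat.lt_succ_iff.1 hl)
  rw [show l + d + 1 - 1 - l = d by omega, pow_add, mul_assoc, ← mul_pow, inv_mul_cancel₀ hr,
    one_pow, mul_one]

/-- The throughput of the first queue is below `mu2` in the stable case. -/
lemma exists_throughput (hlam : 0 < lam) (hmu1 : 0 < mu1) (hmu2 : 0 < mu2) {m : ℕ} (hm : 1 ≤ m)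
    (hst : FiniteStable lam mu1 mu2 m) :
    ∃ c < mu2, c * ∑ l ∈ Finset.range (m + 1), (mu1 / lam) ^ l
      = lam * (mu1 / lam) * ∑ l ∈ Finset.range m, (mu1 / lam) ^ l := by
  obtain ⟨m, rfl⟩ : ∃ k, m = k + 1 := ⟨m - 1, by omega⟩
  have hr0 : 0 < mu1 / lam := by positivity
  have hρ : lam / mu1 = (mu1 / lam)⁻¹ := (inv_div mu1 lam).symm
  set r := mu1 / lam with hr
  have hpos : ∀ (x : ℝ) (n : ℕ), 0 < x → 0 < ∑ l ∈ Finset.range (n + 1), x ^ l := fun x n hx =>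
    Finset.sum_pos (fun _ _ => pow_pos hx _) ⟨0, by simp⟩
  have hri : 0 < r⁻¹ := inv_pos.2 hr0
  have hB := hpos r⁻¹ m hri
  -- Both cases of the stability condition are the same statement about a quotient of geometric sums
  -- in lam / mu1; reversing the sums expresses it through mu1 / lam.
  have hkey : lam / mu2 < (∑ l ∈ Finset.range (m + 1 + 1), r⁻¹ ^ l) /
      ∑ l ∈ Finset.range (m + 1), r⁻¹ ^ l := by
    rcases eq_or_ne r⁻¹ 1 with h1 | h1
    · have := hst.2 (hρ.trans h1)
      rw [h1]
      simp only [one_pow, Finset.sum_const, Finset.card_range, nsmul_eq_mul, mul_one]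
      refine this.trans_eq ?_
      have : ((m + 1 : ℕ) : ℝ) ≠ 0 := by positivity
      field_simp
      push_cast
      ring
    · have h := hst.1 (hρ ▸ h1)
      rw [hρ] at h
      rw [geom_sum_eq h1, geom_sum_eq h1, div_div_div_cancel_right₀ (sub_ne_zero.2 h1),
        ← neg_sub 1, ← neg_sub 1 (r⁻¹ ^ (m + 1)), neg_div_neg_eq]
      exact h
  have hA := hpos r (m + 1) hr0
  refine ⟨lam * r * (∑ l ∈ Finset.range (m + 1), r ^ l) / ∑ l ∈ Finset.range (m + 1 + 1), r ^ l,
    ?_, by rw [div_mul_cancel₀ _ hA.ne']⟩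
  rw [div_lt_iff₀ hA]
  rw [div_lt_div_iff₀ hmu2 hB, ← pow_mul_geom_sum_inv hr0.ne', ← pow_mul_geom_sum_inv hr0.ne'] at hkey
  have hq : 0 < r⁻¹ ^ (m + 1) := pow_pos hri _
  have h3 : r⁻¹ ^ m = r⁻¹ ^ (m + 1) * r := by rw [pow_succ, mul_assoc, inv_mul_cancel₀ hr0.ne', mul_one]
  rw [h3] at hkey
  refine lt_of_mul_lt_mul_left ?_ hq.le
  linarith

/-- Negative drift of the level gives a supersolution that grows geometrically in the level. -/
lemma exists_growing_supersolution (hlam : 0 < lam) (hmu1 : 0 < mu1) (hmu2 : 0 < mu2) {m : ℕ}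
    (hm : 1 ≤ m) (hst : FiniteStable lam mu1 mu2 m) :
    ∃ z : ℝ, 1 < z ∧ ∃ v : ℕ → ℝ, (∀ n, 0 ≤ v n) ∧ (∀ n ≤ m, 0 < v n) ∧ ∀ n ≤ m,
      (if n < m then lam * v (n + 1) else 0) + (if 0 < n then mu1 * (z * v (n - 1)) else 0) +
        mu2 * (z⁻¹ * v n) ≤ (outRate lam mu1 m n + mu2) * v n := by
  obtain ⟨c, hc2, hc⟩ := exists_throughput hlam hmu1 hmu2 hm hst
  set w := poissonSol lam mu1 c with hw
  have hdrift := fun n (hn : n ≤ m) => poissonSol_drift hlam hm hc hn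
  rw [← hw] at hdrift
  -- With v = 1 + ε w and z = 1 + ε, the excess in the required inequality is exactly ε q(n, ε), and
  -- q(n, 0) = c - mu2 < 0 by the Poisson equation. Continuity yields one small ε for the finitely
  -- many phases.
  set q : ℕ → ℝ → ℝ := fun n ε => (if n < m then lam * (w (n + 1) - w n) else 0) +
    (if 0 < n then mu1 * (w (n - 1) - w n + 1 + ε * w (n - 1)) else 0)
      - mu2 * (1 + ε * w n) / (1 + ε) with hq
  have hqev : ∀ n ≤ m, ∀ᶠ ε in 𝓝 (0 : ℝ), q n ε < 0 := by
    intro n hn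
    have hcont : ContinuousAt (q n) 0 := by
      refine ContinuousAt.sub (ContinuousAt.add continuousAt_const ?_) ?_
      · split_ifs
        · fun_prop
        · exact continuousAt_const
      · refine ContinuousAt.div (by fun_prop) (by fun_prop) (by norm_num)
    refine hcont.eventually_lt_const ?_
    have := hdrift n hn
    simp only [hq, zero_mul, add_zero, mul_one, div_one]
    linarith
  have hvev : ∀ n ≤ m, ∀ᶠ ε in 𝓝 (0 : ℝ), 0 < 1 + ε * w n := by
    intro n _
    have hcont : ContinuousAt (fun ε : ℝ => 1 + ε * w n) 0 := by fun_prop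
    exact hcont.eventually_const_lt (by simp)
  have hev : ∀ᶠ ε in 𝓝[>] (0 : ℝ), ∀ n ∈ Finset.range (m + 1), q n ε < 0 ∧ 0 < 1 + ε * w n := by
    refine nhdsWithin_le_nhds ((Filter.eventually_all_finset _).2 fun n hn => ?_)
    have hn' : n ≤ m := by simpa [Nat.lt_succ_iff] using hn
    exact (hqev n hn').and (hvev n hn')
  obtain ⟨ε, hε, hε0⟩ := (hev.and self_mem_nhdsWithin).exists
  have hε0 : 0 < ε := hε0
  have hpos : ∀ n ≤ m, 0 < 1 + ε * w n := fun n hn => (hε n (by simpa [Nat.lt_succ_iff])).2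
  have habs : ∀ n ≤ m, |1 + ε * w n| = 1 + ε * w n := fun n hn => abs_of_pos (hpos n hn)
  -- The absolute value only serves to make the weight nonnegative beyond phase m; up to m it
  -- changes nothing.
  refine ⟨1 + ε, by linarith, fun n => |1 + ε * w n|, fun n => abs_nonneg _,
    fun n hn => by simpa only [habs n hn] using hpos n hn, fun n hn => ?_⟩
  have hqn := (hε n (by simpa [Nat.lt_succ_iff])).1
  have e1 : (if n < m then lam * |1 + ε * w (n + 1)| else 0)
      = (if n < m then lam else 0) * (1 + ε * w n)
        + ε * (if n < m then lam * (w (n + 1) - w n) else 0) := by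
    split_ifs with h
    · rw [habs _ (by omega)]; ring
    · simp
  have e2 : (if 0 < n then mu1 * ((1 + ε) * |1 + ε * w (n - 1)|) else 0)
      = (if 0 < n then mu1 else 0) * (1 + ε * w n)
        + ε * (if 0 < n then mu1 * (w (n - 1) - w n + 1 + ε * w (n - 1)) else 0) := by
    split_ifs with h
    · rw [habs _ (by omega)]; ring
    · simp
  have e3 : mu2 * ((1 + ε)⁻¹ * (1 + ε * w n))
      = mu2 * (1 + ε * w n) - ε * (mu2 * (1 + ε * w n) / (1 + ε)) := by
    have : (1 + ε) ≠ 0 := by positivity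
    field_simp
    ring
  have hcast : ((n : ℕ∞) < (m : ℕ∞)) ↔ n < m := by exact_mod_cast Iff.rfl
  simp only [outRate, hcast]
  rw [e1, e2, habs n hn, e3]
  have := mul_neg_of_pos_of_neg hε0 hqn
  simp only [hq] at this
  linarith

end Drift

/-! ### The decay rate is below one for finite capacity -/

section Finite

variable {lam mu1 mu2 : ℝ}

lemma finNum_iff (m : ℕ) (n : ℕ) : (n : ℕ∞) ≤ (m : ℕ∞) ↔ ∃ i : Fin (m + 1), (i : ℕ) = n := by
  rw [Nat.cast_le]
  exact ⟨fun h => ⟨⟨n, Nat.lt_succ_of_le h⟩, rfl⟩, fun ⟨i, hi⟩ => hi ▸ Nat.lt_succ_iff.1 i.2⟩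

lemma tandemFin_exists_decayRate (hlam : 0 < lam) (hmu1 : 0 < mu1) (hmu2 : 0 < mu2) {m : ℕ}
    (hm : 1 ≤ m) (hst : FiniteStable lam mu1 mu2 m) :
    ∃ h : ℝ, IsMaximalEigenvalue (tandemFin lam mu1 mu2 m).H h ∧ 0 < h ∧ h < 1 ∧
      ∀ i j : Fin (m + 1), (j : ℕ) < m →
        Tendsto (fun K : ℕ => Real.log ((tandemFin lam mu1 mu2 m).hitProb 1 K i j) / (K : ℝ))
          atTop (𝓝 (Real.log h)) := by
  have hinj : Function.Injective (fun i : Fin (m + 1) => (i : ℕ)) := Fin.val_injective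
  have hnum := finNum_iff m
  have hm' : (1 : ℕ∞) ≤ (m : ℕ∞) := by exact_mod_cast hm
  have hlt : ∀ {n : ℕ}, ((n : ℕ∞) < (m : ℕ∞)) ↔ n < m := by
    intro n; exact_mod_cast Iff.rfl
  have h0 := tandem_exitRate_ne_zero hinj hnum hlam hmu1 hmu2 hm'
  have h1 := tandem_exitRate_ne_top hinj hnum hlam hmu1 hmu2
  have hHpos := fun i j hj => tandem_H_pos hinj hnum hlam hmu1 hmu2 hm' (j := j) i hj
  have hHzero := fun i j hj => tandem_H_eq_zero hinj hnum hlam hmu1 hmu2 hm' (j := j) i hj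
  obtain ⟨h, v, hh, hv, hHv⟩ := exists_pos_eigenvector (tandemFin lam mu1 mu2 m).H
    (fun j => ((j : ℕ) : ℕ∞) < (m : ℕ∞)) ⟨0, hlt.2 (by simpa using (show 0 < m by omega))⟩ hHpos hHzero
  have hHnn : ∀ i j, 0 ≤ (tandemFin lam mu1 mu2 m).H i j := fun i j => by
    by_cases hj : ((j : ℕ) : ℕ∞) < (m : ℕ∞)
    · exact (hHpos i j hj).le
    · exact (hHzero i j hj).ge
  refine ⟨h, isMaximalEigenvalue_of_pos hHnn hv hHv, hh, ?_, fun i j hj =>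
    tandem_tendsto_log_hitProb hinj hnum hlam hmu1 hmu2 hm' hh hv hHv i (hlt.2 hj)⟩
  obtain ⟨z, hz, w, hw0, hw, hsup⟩ := exists_growing_supersolution hlam hmu1 hmu2 hm hst
  have hz0 : 0 < z := by linarith
  -- The supersolution z^k w bounds each one-level matrix; the power z^k cancels and the limit gives
  -- z H w ≤ w.
  have hHw : ∀ i, z * ∑ j, (tandemFin lam mu1 mu2 m).H i j * w j ≤ w i := by
    intro i
    have hk : ∀ k, z * ∑ j, (tandemFin lam mu1 mu2 m).hitProb k (k + 1) i j * w j ≤ w i := by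
      intro k
      have := tandem_sum_hitProb_mul_le hinj hnum hlam hmu1 hmu2 hm' (fun k n => z ^ k * w n)
        (fun k n => mul_nonneg (pow_nonneg hz0.le k) (hw0 n)) (fun k n hk hn => by
          have hs := mul_le_mul_of_nonneg_left (hsup n (by exact_mod_cast hn))
            (pow_nonneg hz0.le k)
          obtain ⟨k, rfl⟩ : ∃ k', k = k' + 1 := ⟨k - 1, by omega⟩
          have e3 : z ^ (k + 1) * z⁻¹ = z ^ k := by
            rw [pow_succ, mul_assoc, mul_inv_cancel₀ hz0.ne', mul_one]
          simp only [hlt]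
          rw [Nat.add_sub_cancel, ← e3]
          refine le_trans (le_of_eq ?_) (hs.trans_eq (by ring))
          split_ifs <;> ring) (k + 1) k i
      refine le_of_mul_le_mul_left (a := z ^ k) (le_trans (le_of_eq ?_) this) (pow_pos hz0 k)
      rw [Finset.mul_sum, Finset.mul_sum]
      refine Finset.sum_congr rfl fun j _ => ?_
      rw [tandemFin]
      ring
    refine le_of_tendsto' (Tendsto.const_mul z (tendsto_finsetSum _ fun j _ =>
      (QBD.tendsto_H h0 h1 i j).mul_const _)) hk
  -- Comparing v with w at an index of maximal ratio gives z h ≤ 1.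
  obtain ⟨i, hi⟩ := Finite.exists_max fun i : Fin (m + 1) => v i / w i
  have hwi : ∀ j : Fin (m + 1), 0 < w j := fun j => hw j (Nat.lt_succ_iff.1 j.2)
  set M := v i / w i
  have hM : 0 < M := div_pos (hv i) (hwi i)
  have hvM : ∀ j, v j ≤ M * w j := fun j => (div_le_iff₀ (hwi j)).1 (hi j)
  have hMi : v i = M * w i := (div_mul_cancel₀ _ (hwi i).ne').symm
  have hle : z * (h * v i) ≤ v i := by
    have hHvi : ∑ j, (tandemFin lam mu1 mu2 m).H i j * v j = h * v i := congrFun hHv i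
    calc z * (h * v i) ≤ z * ∑ j, (tandemFin lam mu1 mu2 m).H i j * (M * w j) := by
          rw [← hHvi]
          exact mul_le_mul_of_nonneg_left (Finset.sum_le_sum fun j _ =>
            mul_le_mul_of_nonneg_left (hvM j) (hHnn i j)) hz0.le
      _ = M * (z * ∑ j, (tandemFin lam mu1 mu2 m).H i j * w j) := by
          simp only [Finset.mul_sum]
          exact Finset.sum_congr rfl fun j _ => by ring
      _ ≤ M * w i := mul_le_mul_of_nonneg_left (hHw i) hM.le
      _ = v i := hMi.symm
  have hzh : z * h ≤ 1 := by
    have : z * h * v i ≤ 1 * v i := by linarith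
    exact le_of_mul_le_mul_right this (hv i)
  nlinarith

end Finite

/-! ### Bounds for an unlimited first queue -/

section Infinite

variable {lam mu1 mu2 : ℝ}

lemma infNum_iff (n : ℕ) : (n : ℕ∞) ≤ ⊤ ↔ ∃ i : ℕ, (fun i => i) i = n := by simp

lemma infNum_injective : Function.Injective (fun i : ℕ => i) := fun _ _ h => h

lemma outRate_top (n : ℕ) : outRate lam mu1 ⊤ n = lam + if 0 < n then mu1 else 0 := by
  simp [outRate]

/-! ### Upper bounds from exponential supersolutions -/

section Upper

/-- The supersolution is z^{-k} x^n: `hbd` is its inequality at the empty first queue, and `hint`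
the one at n ≥ 1 after division by common powers. -/
lemma tandemInf_hitProb_le (hlam : 0 < lam) (hmu1 : 0 < mu1) (hmu2 : 0 < mu2) {z x : ℝ}
    (hz : 0 < z) (hx : 0 < x) (hbd : lam * x + mu2 * z ≤ lam + mu2)
    (hint : lam * x ^ 2 + mu1 / z + mu2 * z * x ≤ (lam + mu1 + mu2) * x) (K i j : ℕ) :
    (tandemInf lam mu1 mu2).hitProb 1 K i j ≤ z⁻¹ * x ^ i / x ^ j * z ^ K := by
  have h := tandem_hitProb_mul_le infNum_injective infNum_iff hlam hmu1 hmu2 le_top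
    (fun k n => z⁻¹ ^ k * x ^ n) (fun k n => by positivity) (fun k n hk _ => by
      obtain ⟨k, rfl⟩ : ∃ k', k = k' + 1 := ⟨k - 1, by omega⟩
      have hzk : 0 ≤ z⁻¹ ^ (k + 1) := by positivity
      have e3 : z⁻¹ ^ k = z⁻¹ ^ (k + 1) * z := by
        rw [pow_succ, mul_assoc, inv_mul_cancel₀ hz.ne', mul_one]
      rw [outRate_top, if_pos (by simp), Nat.add_sub_cancel, e3]
      rcases n with _ | n
      · simp only [lt_irrefl, if_false]
        have := mul_le_mul_of_nonneg_left hbd hzk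
        simp only [pow_zero, zero_add, pow_one]
        linarith
      · rw [if_pos (Nat.succ_pos n), if_pos (Nat.succ_pos n), Nat.add_sub_cancel]
        have := mul_le_mul_of_nonneg_left hint (mul_nonneg hzk (pow_nonneg hx.le n))
        rw [div_eq_mul_inv] at this
        refine le_trans (le_of_eq ?_) (this.trans_eq ?_) <;> ring) K 1 i j
  rw [pow_one] at h
  rw [div_mul_eq_mul_div, le_div_iff₀ (by positivity)]
  have hzK : 0 < z ^ K := by positivity
  have := mul_le_mul_of_nonneg_right h hzK.le
  refine le_trans (le_of_eq ?_) this
  rw [inv_pow, tandemInf]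
  field_simp

end Upper

/-! ### Lower bounds from subsolutions on finitely many phases -/

section Lower

/-- Climbing from level 1 to 2 cannot lower the first queue by more than one, so arbitrary target
phases are available only from level 3 on. -/
lemma tandemInf_hit_ne_zero (hlam : 0 < lam) (hmu1 : 0 < mu1) (hmu2 : 0 < mu2) {K : ℕ}
    (hK : 3 ≤ K) (i j : ℕ) : (tandemInf lam mu1 mu2).hit K (1, i) j ≠ 0 := by
  have h0 := tandem_exitRate_ne_zero infNum_injective infNum_iff hlam hmu1 hmu2 le_top
  have h1 := tandem_exitRate_ne_top infNum_injective infNum_iff hlam hmu1 hmu2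
  have hstep : ∀ {K l j : ℕ}, 1 ≤ K → (tandemInf lam mu1 mu2).hit K (1, i) l ≠ 0 →
      (tandemInf lam mu1 mu2).hit (K + 1) (K, l) j ≠ 0 →
      (tandemInf lam mu1 mu2).hit (K + 1) (1, i) j ≠ 0 := by
    intro K l j hK ha hb hc
    rw [tandemInf, QBD.hit_succ h0 h1 hK, ENNReal.tsum_eq_zero] at hc
    exact (mul_ne_zero ha hb) (hc l)
  induction K, hK using Nat.le_induction generalizing j with
  | base =>
    exact hstep (l := i) one_le_two
      (tandem_hit_succ_ne_zero_of_le infNum_injective infNum_iff hlam hmu1 hmu2 le_top one_ne_zero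
        (by simp) (Nat.le_succ i))
      (tandem_hit_succ_ne_zero infNum_injective infNum_iff hlam hmu1 hmu2 le_top le_rfl i (by simp))
  | succ K hK ih =>
    exact hstep (by omega) (ih i)
      (tandem_hit_succ_ne_zero infNum_injective infNum_iff hlam hmu1 hmu2 le_top (by omega) i
        (by simp))

lemma QBD.hit_mul_hit_le {ι : Type*} {B : QBD ι} (h0 : ∀ x, exitRate B.generator x ≠ 0)
    (h1 : ∀ x, exitRate B.generator x ≠ ∞) {k k' K : ℕ} (hk : k ≤ k') (hK : k' ≤ K) (i i' j : ι) :
    B.hit k' (k, i) i' * B.hit K (k', i') j ≤ B.hit K (k, i) j := by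
  classical
  induction K, hK using Nat.le_induction generalizing j with
  | base =>
    rw [hit_top_level]
    split_ifs with h
    · rw [h, mul_one]
    · simp
  | succ K hK ih =>
    rw [hit_succ h0 h1 hK, hit_succ h0 h1 (hk.trans hK), ← ENNReal.tsum_mul_left]
    refine ENNReal.tsum_le_tsum fun l => ?_
    rw [← mul_assoc]
    exact mul_le_mul_left (ih l) _

/-- The probability of reaching level `K` before level `0` in a phase `≤ M`. -/
def windowProb (lam mu1 mu2 : ℝ) (M K k n : ℕ) : ℝ :=
  (exitVal (tandemInf lam mu1 mu2).generator (offLevels ℕ K)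
    (fun z => if z.1 = K then (if z.2 ≤ M then 1 else 0) else 0) (k, n)).toReal

lemma windowProb_balance (hlam : 0 < lam) (hmu1 : 0 < mu1) (hmu2 : 0 < mu2) (M : ℕ) {K k : ℕ}
    (hk : 0 < k) (hkK : k ≠ K) (n : ℕ) :
    (lam + (if 0 < n then mu1 else 0) + mu2) * windowProb lam mu1 mu2 M K k n =
      lam * windowProb lam mu1 mu2 M K k (n + 1) +
      (if 0 < n then mu1 * windowProb lam mu1 mu2 M K (k + 1) (n - 1) else 0) +
      mu2 * windowProb lam mu1 mu2 M K (k - 1) n := by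
  have h0 := tandem_exitRate_ne_zero infNum_injective infNum_iff hlam hmu1 hmu2 le_top
  have h1 := tandem_exitRate_ne_top infNum_injective infNum_iff hlam hmu1 hmu2
  set f := exitVal (tandemInf lam mu1 mu2).generator (offLevels ℕ K)
    (fun z => if z.1 = K then (if z.2 ≤ M then 1 else 0) else 0) with hf
  have hfin : ∀ x, f x ≠ ∞ := fun x => ne_top_of_le_ne_top ENNReal.one_ne_top
    (exitVal_le_one (fun z => by split_ifs <;> simp) x)
  have h := exitRate_mul_exitVal (C := offLevels ℕ K)
    (b := fun z => if z.1 = K then (if z.2 ≤ M then 1 else 0) else 0) h0 h1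
    (x := (k, n)) ⟨hk.ne', hkK⟩
  have hf' : exitVal (tandem (fun i : ℕ => i) lam mu1 mu2 ⊤).generator (offLevels ℕ K)
    (fun z => if z.1 = K then (if z.2 ≤ M then 1 else 0) else 0) = f := rfl
  have hsum := tandem_tsum_rate (lam := lam) (mu1 := mu1) (mu2 := mu2) infNum_injective infNum_iff
    f k n
  rw [hf'] at h
  simp only [Prod.mk.eta] at hsum
  have htop : (n : ℕ∞) < ⊤ := ENat.natCast_lt_top n
  rw [hsum, tandem_exitRate infNum_injective infNum_iff hlam hmu1 hmu2, outRate_top, if_pos hk,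
    if_pos hk, if_pos htop] at h
  have h' := congrArg ENNReal.toReal h
  have hw : ∀ k n, windowProb lam mu1 mu2 M K k n = (f (k, n)).toReal := fun _ _ => rfl
  simp only [hw]
  rw [ENNReal.toReal_mul, ENNReal.toReal_ofReal (by positivity)] at h'
  rw [h']
  have t : ∀ (c : ℝ) x, ENNReal.ofReal c * f x ≠ ∞ := fun c x =>
    ENNReal.mul_ne_top ENNReal.ofReal_ne_top (hfin x)
  have tm : ∀ {c : ℝ} x, 0 < c → (ENNReal.ofReal c * f x).toReal = c * (f x).toReal := by
    intro c x hc
    rw [ENNReal.toReal_mul, ENNReal.toReal_ofReal hc.le]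
  rw [ENNReal.toReal_add _ (t _ _), ENNReal.toReal_add (t _ _), tm _ hlam, tm _ hmu2]
  · split_ifs
    · rw [tm _ hmu1]
    · simp
  · split_ifs
    · exact t _ _
    · simp
  · refine ENNReal.add_ne_top.2 ⟨t _ _, ?_⟩
    split_ifs
    · exact t _ _
    · simp

lemma windowProb_nonneg (M K k n : ℕ) : 0 ≤ windowProb lam mu1 mu2 M K k n :=
  ENNReal.toReal_nonneg

lemma windowProb_top_level {M n : ℕ} (K : ℕ) (hn : n ≤ M) :
    windowProb lam mu1 mu2 M K K n = 1 := by
  rw [windowProb, exitVal_of_notMem (by simp [offLevels])]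
  simp [hn]

/-- Comparison of `windowProb` with a subsolution that is supported in the phases `≤ M`. -/
lemma sub_le_windowProb (hlam : 0 < lam) (hmu1 : 0 < mu1) (hmu2 : 0 < mu2) {z A : ℝ} (hz : 0 < z)
    {v : ℕ → ℝ} {M : ℕ} (hM : ∀ n, M < n → v n = 0) (hA : ∀ n, v n ≤ A) (hA0 : 0 ≤ A)
    (hsub : ∀ n, (lam + (if 0 < n then mu1 else 0) + mu2) * v n ≤
      lam * v (n + 1) + (if 0 < n then mu1 / z * v (n - 1) else 0) + mu2 * z * v n)
    {K k : ℕ} (hk : k ≤ K) (n : ℕ) :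
    z⁻¹ ^ k * v n - A ≤ A * z⁻¹ ^ K * windowProb lam mu1 mu2 M K k n := by
  -- Discrete maximum principle for w: it is nonpositive at levels 0 and K and in phases above M,
  -- and satisfies the balance inequality between the two levels.
  set w : ℕ → ℕ → ℝ := fun k n => z⁻¹ ^ k * v n - A - A * z⁻¹ ^ K * windowProb lam mu1 mu2 M K k n
    with hw
  have hAK : 0 ≤ A * z⁻¹ ^ K := by positivity
  have hw0 : ∀ n, w 0 n ≤ 0 := fun n => by
    have := mul_nonneg hAK (windowProb_nonneg (lam := lam) (mu1 := mu1) (mu2 := mu2) M K 0 n)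
    simp only [hw, pow_zero, one_mul]
    linarith [hA n]
  have hwM : ∀ k n, M < n → w k n ≤ 0 := fun k n hn => by
    have := mul_nonneg hAK (windowProb_nonneg (lam := lam) (mu1 := mu1) (mu2 := mu2) M K k n)
    simp only [hw, hM n hn, mul_zero]
    linarith
  have hwK : ∀ n, w K n ≤ 0 := fun n => by
    rcases lt_or_ge M n with hn | hn
    · exact hwM K n hn
    · simp only [hw, windowProb_top_level K hn]
      have := mul_le_mul_of_nonneg_left (hA n) (by positivity : 0 ≤ z⁻¹ ^ K)
      linarith
  have hwsub : ∀ k n, 0 < k → k < K → (lam + (if 0 < n then mu1 else 0) + mu2) * w k n ≤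
      lam * w k (n + 1) + (if 0 < n then mu1 * w (k + 1) (n - 1) else 0) + mu2 * w (k - 1) n := by
    intro k n hk hkK
    have hb := windowProb_balance hlam hmu1 hmu2 M hk hkK.ne n
    have hzk : 0 ≤ z⁻¹ ^ k := by positivity
    have hs := mul_le_mul_of_nonneg_left (hsub n) hzk
    obtain ⟨k, rfl⟩ : ∃ k', k = k' + 1 := ⟨k - 1, by omega⟩
    have e3 : z⁻¹ ^ k = z⁻¹ ^ (k + 1) * z := by
      rw [pow_succ, mul_assoc, inv_mul_cancel₀ hz.ne', mul_one]
    simp only [hw]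
    rw [Nat.add_sub_cancel] at hb ⊢
    have hb' := congrArg (fun t => A * z⁻¹ ^ K * t) hb
    rw [e3, pow_succ _ (k + 1)]
    rw [div_eq_mul_inv] at hs
    split_ifs at hs hb' ⊢ <;> nlinarith [hs, hb']
  -- Phase M + 1 belongs to the box so that the upper neighbour of any phase up to M is compared as
  -- well.
  obtain ⟨⟨k₁, n₁⟩, hmem, hmax⟩ := Finset.exists_max_image
    (Finset.range (K + 1) ×ˢ Finset.range (M + 2)) (fun q => w q.1 q.2)
    ⟨(0, 0), by simp⟩
  have hmax' : ∀ k n, k ≤ K → n ≤ M + 1 → w k n ≤ w k₁ n₁ := fun k n hk hn =>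
    hmax (k, n) (by simp; omega)
  have hmem' : k₁ ≤ K ∧ n₁ ≤ M + 1 := by
    simp only [Finset.mem_product, Finset.mem_range] at hmem
    omega
  have key : ∀ k ≤ K, ∀ n ≤ M + 1, w k n = w k₁ n₁ → w k₁ n₁ ≤ 0 := by
    intro k
    induction k with
    | zero => intro _ n _ h; exact h ▸ hw0 n
    | succ k ih =>
      intro hk n hn h
      rcases eq_or_ne (k + 1) K with hkK | hkK
      · rw [← h, hkK]; exact hwK n
      rcases lt_or_ge M n with hMn | hMn
      · rw [← h]; exact hwM _ n hMn
      -- At an interior maximum the neighbours do not exceed it, so the balance inequality forces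
      -- the same value one level below; the descent ends where w ≤ 0.
      refine ih (by omega) n hn (le_antisymm (hmax' _ _ (by omega) hn) ?_)
      have hs := hwsub (k + 1) n (Nat.succ_pos k) (by omega)
      rw [h, Nat.add_sub_cancel] at hs
      have a1 := mul_le_mul_of_nonneg_left (hmax' (k + 1) (n + 1) hk (by omega)) hlam.le
      have a2 := mul_le_mul_of_nonneg_left (hmax' (k + 1 + 1) (n - 1) (by omega) (by omega)) hmu1.le
      refine le_of_mul_le_mul_left ?_ hmu2
      split_ifs at hs <;> linarith
  have hle := key k₁ hmem'.1 n₁ hmem'.2 rfl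
  rcases lt_or_ge M n with hn | hn
  · have := hwM k n hn
    simp only [hw] at this
    linarith
  · have := (hmax' k n hk (by omega)).trans hle
    simp only [hw] at this
    linarith

lemma windowProb_eq_sum (M K k n : ℕ) :
    windowProb lam mu1 mu2 M K k n
      = (∑ l ∈ Finset.range (M + 1), (tandemInf lam mu1 mu2).hit K (k, n) l).toReal := by
  rw [windowProb, QBD.exitVal_level K (fun l => if l ≤ M then 1 else 0)]
  congr 1
  rw [tsum_eq_sum (s := Finset.range (M + 1))]
  · refine Finset.sum_congr rfl fun l hl => ?_
    rw [if_pos (Nat.lt_succ_iff.1 (Finset.mem_range.1 hl)), mul_one]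
  · intro l hl
    rw [if_neg (by simpa [Nat.lt_succ_iff] using hl), mul_zero]

/-- A subsolution with finitely many phases gives a lower bound of the hitting probabilities. -/
lemma tandemInf_le_hitProb (hlam : 0 < lam) (hmu1 : 0 < mu1) (hmu2 : 0 < mu2) {z : ℝ} (hz : 0 < z)
    (hz1 : z < 1) {v : ℕ → ℝ} (hv : ∀ n, 0 ≤ v n) {M : ℕ} (hM : ∀ n, M < n → v n = 0)
    {n₀ : ℕ} (hn₀ : 0 < v n₀)
    (hsub : ∀ n, (lam + (if 0 < n then mu1 else 0) + mu2) * v n ≤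
      lam * v (n + 1) + (if 0 < n then mu1 / z * v (n - 1) else 0) + mu2 * z * v n) (i j : ℕ) :
    ∃ c, 0 < c ∧ ∀ᶠ K in atTop, c * z ^ K ≤ (tandemInf lam mu1 mu2).hitProb 1 K i j := by
  have h0 := tandem_exitRate_ne_zero infNum_injective infNum_iff hlam hmu1 hmu2 le_top
  have h1 := tandem_exitRate_ne_top infNum_injective infNum_iff hlam hmu1 hmu2
  set A := ∑ n ∈ Finset.range (M + 1), v n with hAdef
  have hA : ∀ n, v n ≤ A := by
    intro n
    rcases lt_or_ge M n with hn | hn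
    · rw [hM n hn]; exact Finset.sum_nonneg fun n _ => hv n
    · exact Finset.single_le_sum (fun n _ => hv n) (Finset.mem_range.2 (Nat.lt_succ_of_le hn))
  have hApos : 0 < A := hn₀.trans_le (hA n₀)
  -- The factor 2 leaves A after A is subtracted in `sub_le_windowProb`, so the window probability
  -- from this start is at least z^K; k₀ ≥ 3 makes the start reachable from (1, i).
  obtain ⟨k₀, hk₀3, hk₀⟩ : ∃ k₀, 3 ≤ k₀ ∧ 2 * A ≤ z⁻¹ ^ k₀ * v n₀ := by
    have ht : Tendsto (fun k : ℕ => z⁻¹ ^ k * v n₀) atTop atTop :=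
      (tendsto_pow_atTop_atTop_of_one_lt ((one_lt_inv₀ hz).2 hz1)).atTop_mul_const hn₀
    obtain ⟨k, hk⟩ := ((ht.eventually_ge_atTop (2 * A)).and (eventually_ge_atTop 3)).exists
    exact ⟨k, hk.2, hk.1⟩
  have hwin : ∀ K, k₀ ≤ K → z ^ K ≤ windowProb lam mu1 mu2 M K k₀ n₀ := by
    intro K hK
    have h := sub_le_windowProb hlam hmu1 hmu2 hz hM hA hApos.le hsub hK n₀
    have h2 : A * 1 ≤ A * (z⁻¹ ^ K * windowProb lam mu1 mu2 M K k₀ n₀) := by linarith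
    have h3 := le_of_mul_le_mul_left h2 hApos
    have h4 := mul_le_mul_of_nonneg_left h3 (pow_pos hz K).le
    rwa [mul_one, ← mul_assoc, ← mul_pow, mul_inv_cancel₀ hz.ne', one_pow, one_mul] at h4
  -- Only finitely many phases lie in the window, and one-level probabilities increase with the
  -- level, so one δ bounds the last step to phase j from below for all K.
  obtain ⟨l₀, -, hl₀⟩ := Finset.exists_min_image (Finset.range (M + 1))
    (fun l => (tandemInf lam mu1 mu2).hit 3 (2, l) j) ⟨0, by simp⟩
  set δ := (tandemInf lam mu1 mu2).hit 3 (2, l₀) j with hδ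
  have hδ0 : δ ≠ 0 := tandem_hit_succ_ne_zero infNum_injective infNum_iff hlam hmu1 hmu2 le_top
    le_rfl l₀ (by simp)
  have hmono : ∀ K, 2 ≤ K → ∀ l, (tandemInf lam mu1 mu2).hit 3 (2, l) j
      ≤ (tandemInf lam mu1 mu2).hit (K + 1) (K, l) j := by
    intro K hK l
    induction K, hK using Nat.le_induction with
    | base => exact le_rfl
    | succ K hK ih => exact ih.trans (QBD.hit_shift_le h0 h1 K l j)
  set c₀ := (tandemInf lam mu1 mu2).hit k₀ (1, i) n₀ with hc₀
  have hc₀0 : c₀ ≠ 0 := tandemInf_hit_ne_zero hlam hmu1 hmu2 hk₀3 i n₀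
  have hmain : ∀ K, k₀ ≤ K → c₀ * δ * ∑ l ∈ Finset.range (M + 1),
      (tandemInf lam mu1 mu2).hit K (k₀, n₀) l ≤ (tandemInf lam mu1 mu2).hit (K + 1) (1, i) j := by
    intro K hK
    calc _ = ∑ l ∈ Finset.range (M + 1), c₀ * (tandemInf lam mu1 mu2).hit K (k₀, n₀) l * δ := by
          rw [Finset.mul_sum]
          exact Finset.sum_congr rfl fun l _ => by ring
      _ ≤ ∑ l ∈ Finset.range (M + 1), (tandemInf lam mu1 mu2).hit K (1, i) l *
            (tandemInf lam mu1 mu2).hit (K + 1) (K, l) j :=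
          Finset.sum_le_sum fun l hl => mul_le_mul'
            (QBD.hit_mul_hit_le h0 h1 (by omega) hK i n₀ l) ((hl₀ l hl).trans (hmono K (by omega) l))
      _ ≤ ∑' l, (tandemInf lam mu1 mu2).hit K (1, i) l *
            (tandemInf lam mu1 mu2).hit (K + 1) (K, l) j := ENNReal.sum_le_tsum _
      _ = _ := (QBD.hit_succ h0 h1 (by omega) i j).symm
  have hcpos : 0 < (c₀ * δ).toReal := ENNReal.toReal_pos (mul_ne_zero hc₀0 hδ0)
    (ENNReal.mul_ne_top (QBD.hit_ne_top _ _ _) (QBD.hit_ne_top _ _ _))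
  refine ⟨(c₀ * δ).toReal / z, div_pos hcpos hz, ?_⟩
  filter_upwards [eventually_ge_atTop (k₀ + 1)] with K hK
  obtain ⟨K, rfl⟩ : ∃ K', K = K' + 1 := ⟨K - 1, by omega⟩
  rw [show (tandemInf lam mu1 mu2).hitProb 1 (K + 1) i j = _ from QBD.hitProb_eq_hit h0 h1 _ _ _ _]
  refine le_trans ?_ (ENNReal.toReal_mono (QBD.hit_ne_top _ _ _) (hmain K (by omega)))
  have e : (c₀ * δ * ∑ l ∈ Finset.range (M + 1), (tandemInf lam mu1 mu2).hit K (k₀, n₀) l).toReal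
      = (c₀ * δ).toReal * windowProb lam mu1 mu2 M K k₀ n₀ := by
    rw [windowProb_eq_sum]; exact ENNReal.toReal_mul
  rw [e, pow_succ, div_mul_eq_mul_div, div_le_iff₀ hz, ← mul_assoc]
  exact mul_le_mul_of_nonneg_right
    (mul_le_mul_of_nonneg_left (hwin K (by omega)) hcpos.le) hz.le

end Lower

end Infinite

/-! ### The two decay regimes for an unlimited first queue -/

section DecayInfinite

variable {lam mu1 mu2 : ℝ}

/-! ### Zeros and signs of tau -/

section Tau

/-- In the variable √z the function becomes a cubic, convex on the positive half-line. -/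
lemma tau_mul_sqrt {z : ℝ} (hz : 0 < z) : tau lam mu1 mu2 z * √z =
    2 * √(lam * mu1) - (lam + mu1 + mu2) * √z + mu2 * √z ^ 3 := by
  have hs : √z ≠ 0 := (Real.sqrt_pos.2 hz).ne'
  have h2 : z = √z ^ 2 := (Real.sq_sqrt hz.le).symm
  rw [tau, Real.sqrt_div' _ hz.le]
  field_simp
  nth_rewrite 1 [h2]
  ring

lemma two_mul_sqrt_lt (hlam : 0 < lam) (hmu1 : 0 < mu1) (h : lam < mu1) :
    2 * √(lam * mu1) < lam + mu1 := by
  rw [Real.sqrt_mul hlam.le]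
  have h1 := Real.sq_sqrt hlam.le
  have h2 := Real.sq_sqrt hmu1.le
  have h3 : √lam < √mu1 := Real.sqrt_lt_sqrt hlam.le h
  nlinarith [sq_pos_of_pos (sub_pos.2 h3)]

/-- The cubic in √z is negative at 1, because 2√(lam mu1) < lam + mu1. By convexity, once it is
nonpositive at √a it is negative strictly between √a and 1; the identity `e` is this chord
inequality with its remainder. Hence tau changes sign only once. -/
lemma tau_neg_of_le (hlam : 0 < lam) (hmu1 : 0 < mu1) (hmu2 : 0 < mu2) (h : lam < mu1) {a b : ℝ}
    (ha : 0 < a) (hab : a < b) (hb : b < 1) (hτ : tau lam mu1 mu2 a ≤ 0) :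
    tau lam mu1 mu2 b < 0 := by
  have hya : 0 < √a := Real.sqrt_pos.2 ha
  have hyb : 0 < √b := Real.sqrt_pos.2 (ha.trans hab)
  have hlt : √a < √b := Real.sqrt_lt_sqrt ha.le hab
  have hb1 : √b < 1 := by rw [Real.sqrt_lt' one_pos]; simpa using hb
  have h1 := mul_nonpos_of_nonpos_of_nonneg hτ hya.le
  rw [tau_mul_sqrt ha] at h1
  have h2 := two_mul_sqrt_lt hlam hmu1 h
  suffices tau lam mu1 mu2 b * √b < 0 by
    by_contra hcon
    exact absurd this (not_lt.2 (mul_nonneg (not_lt.1 hcon) hyb.le))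
  rw [tau_mul_sqrt (ha.trans hab)]
  set y := √a
  set w := √b
  set s := √(lam * mu1)
  have e : (1 - y) * (2 * s - (lam + mu1 + mu2) * w + mu2 * w ^ 3) =
      (1 - w) * (2 * s - (lam + mu1 + mu2) * y + mu2 * y ^ 3) + (w - y) * (2 * s - (lam + mu1))
        - mu2 * ((w - y) * (1 - w) * (1 - y) * (w + y + 1)) := by ring
  have p1 : (1 - w) * (2 * s - (lam + mu1 + mu2) * y + mu2 * y ^ 3) ≤ 0 :=
    mul_nonpos_of_nonneg_of_nonpos (by linarith) h1
  have p2 : (w - y) * (2 * s - (lam + mu1)) < 0 := mul_neg_of_pos_of_neg (by linarith) (by linarith)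
  have p3 : 0 ≤ mu2 * ((w - y) * (1 - w) * (1 - y) * (w + y + 1)) := by
    have : 0 ≤ w - y := by linarith
    have : 0 ≤ 1 - w := by linarith
    have : 0 ≤ 1 - y := by linarith
    positivity
  have : (1 - y) * (2 * s - (lam + mu1 + mu2) * w + mu2 * w ^ 3) < 0 := by rw [e]; linarith
  by_contra hcon
  exact absurd this (not_lt.2 (mul_nonneg (by linarith) (not_lt.1 hcon)))

lemma exists_tau_eq_zero (hlam : 0 < lam) (hmu1 : 0 < mu1) (h : lam < mu1) :
    ∃ η, 0 < η ∧ η < 1 ∧ tau lam mu1 mu2 η = 0 := by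
  set g : ℝ → ℝ := fun y => 2 * √(lam * mu1) - (lam + mu1 + mu2) * y + mu2 * y ^ 3 with hg
  have h0 : 0 < g 0 := by
    have : 0 < √(lam * mu1) := Real.sqrt_pos.2 (by positivity)
    have h2 : g 0 = 2 * √(lam * mu1) := by simp only [hg]; ring
    rw [h2]; linarith
  have h1 : g 1 < 0 := by
    have := two_mul_sqrt_lt hlam hmu1 h
    simp only [hg]; linarith
  obtain ⟨y, ⟨hy0, hy1⟩, hy⟩ := intermediate_value_Ioo' (zero_le_one' ℝ)
    (f := g) (by simp only [hg]; fun_prop) ⟨h1, h0⟩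
  have hy2 : √(y ^ 2) = y := Real.sqrt_sq hy0.le
  refine ⟨y ^ 2, by positivity, by nlinarith, ?_⟩
  have h3 := tau_mul_sqrt (lam := lam) (mu1 := mu1) (mu2 := mu2) (z := y ^ 2) (by positivity)
  rw [hy2] at h3
  exact (mul_eq_zero.1 (h3.trans hy)).resolve_right hy0.ne'

lemma tau_div_mu1 (hlam : 0 < lam) (hmu1 : 0 < mu1) :
    tau lam mu1 mu2 (lam / mu1) = (mu1 - mu2) * (1 - lam / mu1) := by
  have : lam * mu1 / (lam / mu1) = mu1 ^ 2 := by field_simp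
  rw [tau, this, Real.sqrt_sq hmu1.le]
  field_simp
  ring

lemma tau_div_mu2 (hlam : 0 < lam) (hmu2 : 0 < mu2) :
    tau lam mu1 mu2 (lam / mu2) = 2 * √(mu1 * mu2) - (mu1 + mu2) := by
  have : lam * mu1 / (lam / mu2) = mu1 * mu2 := by field_simp
  rw [tau, this]
  field_simp
  ring

end Tau

/-- When the quadratic in x has no real root, solutions oscillate. After factoring out the power of
x that balances upward and downward rates, a concave parabola n (N - n) replaces the sine arch: its
second difference is the constant -2, which the gap 2s - D absorbs for large N. -/
lemma exists_window_subsolution_of_tau_pos (hlam : 0 < lam) (hmu1 : 0 < mu1)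
    {z : ℝ} (hz : 0 < z) (hτ : 0 < tau lam mu1 mu2 z) :
    ∃ (v : ℕ → ℝ) (M n₀ : ℕ), (∀ n, 0 ≤ v n) ∧ (∀ n, M < n → v n = 0) ∧ 0 < v n₀ ∧
      ∀ n, (lam + (if 0 < n then mu1 else 0) + mu2) * v n ≤
        lam * v (n + 1) + (if 0 < n then mu1 / z * v (n - 1) else 0) + mu2 * z * v n := by
  set s := √(lam * mu1 / z) with hs
  have hs0 : 0 < s := Real.sqrt_pos.2 (by positivity)
  have hs2 : s ^ 2 = lam * mu1 / z := Real.sq_sqrt (by positivity)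
  set x := s / lam with hx
  have hx0 : 0 < x := by positivity
  have hlx : lam * x = s := by rw [hx]; field_simp
  have hmz : mu1 / z = s * x := by
    rw [hx, mul_div_assoc', ← sq, hs2]; field_simp
  set D := lam + mu1 + mu2 * (1 - z) with hD
  have hD2 : 0 < 2 * s - D := by
    simp only [tau, ← hs] at hτ
    simp only [hD]; linarith
  obtain ⟨N, hN⟩ := exists_nat_ge (2 * s / (2 * s - D) + 2)
  have hN' : 2 * s ≤ (2 * s - D) * ((N : ℝ) - 1) := by
    have : 2 * s / (2 * s - D) ≤ N - 1 := by linarith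
    rw [div_le_iff₀ hD2] at this
    linarith
  have hN2 : 2 ≤ N := by
    have : (2 : ℝ) ≤ N := le_trans (by have := div_pos (mul_pos two_pos hs0) hD2; linarith) hN
    exact_mod_cast this
  set p : ℕ → ℝ := fun n => ((n * (N - n) : ℕ) : ℝ) with hp
  have hp0 : ∀ n, 0 ≤ p n := fun n => Nat.cast_nonneg _
  refine ⟨fun n => x ^ n * p n, N, 1, fun n => mul_nonneg (pow_nonneg hx0.le n) (hp0 n), ?_, ?_, ?_⟩
  · intro n hn
    simp [hp, Nat.sub_eq_zero_of_le hn.le]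
  · refine mul_pos (pow_pos hx0 1) ?_
    simp only [hp, one_mul]
    exact_mod_cast (by omega : 0 < N - 1)
  · intro n
    rcases n with _ | n
    · have : p 0 = 0 := by simp [hp]
      simp only [this, lt_irrefl, if_false, mul_zero, add_zero]
      exact mul_nonneg hlam.le (mul_nonneg (by positivity) (hp0 _))
    · simp only [Nat.succ_pos, if_true, Nat.add_sub_cancel]
      have key : D * p (n + 1) ≤ s * (p (n + 2) + p n) := by
        rcases lt_or_ge (n + 1) N with h | h
        · obtain ⟨d, hd⟩ := Nat.exists_eq_add_of_lt h
          have e1 : p (n + 1) = ((n : ℝ) + 1) * (d + 1) := by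
            simp only [hp, hd, show n + 1 + d + 1 - (n + 1) = d + 1 by omega]; push_cast; ring
          have e2 : p (n + 2) = ((n : ℝ) + 2) * d := by
            simp only [hp, hd, show n + 1 + d + 1 - (n + 2) = d by omega]; push_cast; ring
          have e3 : p n = (n : ℝ) * (d + 2) := by
            simp only [hp, hd, show n + 1 + d + 1 - n = d + 2 by omega]; push_cast; ring
          have hNd : (N : ℝ) = n + d + 2 := by rw [hd]; push_cast; ring
          have hge : (N : ℝ) - 1 ≤ p (n + 1) := by
            rw [e1, hNd]
            have : (0 : ℝ) ≤ n * d := by positivity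
            linarith
          have hsum : p (n + 2) + p n = 2 * p (n + 1) - 2 := by rw [e1, e2, e3]; ring
          rw [hsum]
          have := mul_le_mul_of_nonneg_left hge hD2.le
          linarith
        · have : p (n + 1) = 0 := by simp [hp, Nat.sub_eq_zero_of_le h]
          rw [this, mul_zero]
          exact mul_nonneg hs0.le (add_nonneg (hp0 _) (hp0 _))
      have := mul_le_mul_of_nonneg_left key (pow_nonneg hx0.le (n + 1))
      rw [hmz]
      have e4 : lam * (x ^ (n + 1 + 1) * p (n + 1 + 1)) = x ^ (n + 1) * (s * p (n + 2)) := by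
        rw [← hlx]; ring
      have e5 : s * x * (x ^ n * p n) = x ^ (n + 1) * (s * p n) := by ring
      rw [e4, e5]
      simp only [hD] at this
      linarith

/-- For z slightly below lam/mu2, the power y^n with y = 1/z is a subsolution including at the empty
queue. Subtracting a small multiple of a faster growing power that is an interior supersolution
makes it negative for large n, and its positive part is still a subsolution. -/
lemma exists_window_subsolution_of_lt (hlam : 0 < lam) (hmu2 : 0 < mu2)
    (hl2 : lam < mu2) (h21 : mu2 < mu1) {s : ℝ} (hs : s < lam / mu2) :
    ∃ z, s < z ∧ 0 < z ∧ z < 1 ∧ ∃ (v : ℕ → ℝ) (M n₀ : ℕ), (∀ n, 0 ≤ v n) ∧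
      (∀ n, M < n → v n = 0) ∧ 0 < v n₀ ∧
      ∀ n, (lam + (if 0 < n then mu1 else 0) + mu2) * v n ≤
        lam * v (n + 1) + (if 0 < n then mu1 / z * v (n - 1) else 0) + mu2 * z * v n := by
  have hmu1 : 0 < mu1 := hmu2.trans h21
  -- The midpoint of the two roots mu2/lam and mu1/lam of the quadratic at z = lam/mu2, hence a
  -- point where it is negative, also for nearby z.
  set x := (mu1 + mu2) / (2 * lam) with hx
  have hρ : 0 < lam / mu2 := by positivity
  have hρ1 : lam / mu2 < 1 := (div_lt_one hmu2).2 hl2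
  have c1 : ∀ᶠ z in 𝓝[<] (lam / mu2),
      lam * x ^ 2 - (lam + mu1 + mu2 * (1 - z)) * x + mu1 / z < 0 := by
    have hc : ContinuousAt (fun z : ℝ => lam * x ^ 2 - (lam + mu1 + mu2 * (1 - z)) * x + mu1 / z)
        (lam / mu2) :=
      ContinuousAt.add (by fun_prop) (ContinuousAt.div (by fun_prop) (by fun_prop) hρ.ne')
    refine nhdsWithin_le_nhds (hc.eventually_lt_const ?_)
    have : lam * x ^ 2 - (lam + mu1 + mu2 * (1 - lam / mu2)) * x + mu1 / (lam / mu2)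
        = - (mu1 - mu2) ^ 2 / (4 * lam) := by
      rw [hx]; field_simp; ring
    refine lt_of_eq_of_lt this ?_
    have : 0 < (mu1 - mu2) ^ 2 := by have := sub_pos.2 h21; positivity
    exact div_neg_of_neg_of_pos (by linarith) (by positivity)
  have c2 : ∀ᶠ z in 𝓝[<] (lam / mu2), z⁻¹ < x := by
    have hc : ContinuousAt (fun z : ℝ => z⁻¹) (lam / mu2) := continuousAt_inv₀ hρ.ne'
    refine nhdsWithin_le_nhds (hc.eventually_lt_const ?_)
    change (lam / mu2)⁻¹ < x
    rw [inv_div, hx, div_lt_div_iff₀ hlam (by positivity)]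
    nlinarith
  have c3 : ∀ᶠ z in 𝓝[<] (lam / mu2), s < z ∧ 0 < z :=
    nhdsWithin_le_nhds ((eventually_gt_nhds hs).and (eventually_gt_nhds hρ))
  obtain ⟨z, hG, hzx, ⟨hsz, hz⟩, hzρ⟩ :=
    (c1.and (c2.and (c3.and self_mem_nhdsWithin))).exists
  have hzρ : z < lam / mu2 := hzρ
  have hz1 : z < 1 := hzρ.trans hρ1
  have hx0 : 0 < x := (inv_pos.2 hz).trans hzx
  set y := z⁻¹ with hy
  have hy0 : 0 < y := inv_pos.2 hz
  have hyz : y * z = 1 := inv_mul_cancel₀ hz.ne'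
  set F : ℝ → ℝ := fun t => lam * t - (lam + mu2 * (1 - z)) with hF
  have hFy : 0 < F y := by
    have h1 : mu2 * z < lam := by rwa [lt_div_iff₀ hmu2, mul_comm] at hzρ
    have h2 : F y = (1 - z) * (lam * y - mu2) := by
      simp only [hF]; linear_combination lam * hyz
    have h3 : mu2 < lam * y := by
      have := mul_lt_mul_of_pos_right h1 hy0
      nlinarith
    rw [h2]
    exact mul_pos (by linarith) (by linarith)
  -- Any β in (0, 1) with β F(x) ≤ F(y) would do: the inequality is the boundary condition in phase
  -- 0, and β < 1 keeps u 0 positive.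
  set β := F y / (F y + |F x| + 1) with hβ
  have hden : 0 < F y + |F x| + 1 := by have := abs_nonneg (F x); linarith
  have hβ0 : 0 < β := div_pos hFy hden
  have hβ1 : β < 1 := by rw [hβ, div_lt_one hden]; linarith [abs_nonneg (F x)]
  have hβF : β * F x ≤ F y := by
    rw [hβ, div_mul_eq_mul_div, div_le_iff₀ hden]
    exact mul_le_mul_of_nonneg_left (by linarith [le_abs_self (F x)]) hFy.le
  set u : ℕ → ℝ := fun n => y ^ n - β * x ^ n with hu
  have hu0 : 0 < u 0 := by simp only [hu, pow_zero]; linarith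
  have husub : ∀ n, (lam + (if 0 < n then mu1 else 0) + mu2) * u n ≤
      lam * u (n + 1) + (if 0 < n then mu1 / z * u (n - 1) else 0) + mu2 * z * u n := by
    intro n
    rcases n with _ | n
    · simp only [lt_irrefl, if_false, hu, pow_zero, zero_add, pow_one, add_zero, mul_one]
      simp only [hF] at hβF
      linarith
    · simp only [Nat.succ_pos, if_true, Nat.add_sub_cancel, hu]
      have hGx := mul_nonpos_of_nonneg_of_nonpos
        (mul_nonneg hβ0.le (pow_nonneg hx0.le n)) hG.le
      have hGy : 0 ≤ y ^ n * (lam * y ^ 2 - (lam + mu1 + mu2 * (1 - z)) * y + mu1 / z) := by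
        refine mul_nonneg (pow_nonneg hy0.le n) ?_
        have : lam * y ^ 2 - (lam + mu1 + mu2 * (1 - z)) * y + mu1 / z = y * F y := by
          rw [div_eq_mul_inv, ← hy]
          simp only [hF]; ring
        rw [this]
        exact (mul_pos hy0 hFy).le
      rw [← sub_nonneg]
      refine le_trans (sub_nonneg.2 (hGx.trans hGy)) (le_of_eq ?_)
      ring
  obtain ⟨M, hM⟩ : ∃ M, ∀ n, M < n → u n ≤ 0 := by
    have ht := tendsto_pow_atTop_nhds_zero_of_lt_one (r := y / x) (by positivity)
      ((div_lt_one hx0).2 hzx)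
    obtain ⟨M, hM⟩ := eventually_atTop.1 (ht.eventually_lt_const hβ0)
    refine ⟨M, fun n hn => ?_⟩
    have := hM n hn.le
    rw [div_pow, div_lt_iff₀ (pow_pos hx0 n)] at this
    simp only [hu]; linarith
  refine ⟨z, hsz, hz, hz1, fun n => max 0 (u n), M, 0, fun n => le_max_left _ _,
    fun n hn => max_eq_left (hM n hn), lt_max_of_lt_right hu0, fun n => ?_⟩
  have a1 : ∀ n, 0 ≤ max 0 (u n) := fun n => le_max_left _ _
  have a2 : ∀ n, u n ≤ max 0 (u n) := fun n => le_max_right _ _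
  have b1 : lam * u (n + 1) ≤ lam * max 0 (u (n + 1)) := mul_le_mul_of_nonneg_left (a2 _) hlam.le
  have b2 : (if 0 < n then mu1 / z * u (n - 1) else 0)
      ≤ (if 0 < n then mu1 / z * max 0 (u (n - 1)) else 0) := by
    split_ifs
    · exact mul_le_mul_of_nonneg_left (a2 _) (by positivity)
    · exact le_rfl
  have b3 : 0 ≤ lam * max 0 (u (n + 1)) := mul_nonneg hlam.le (a1 _)
  have b4 : 0 ≤ (if 0 < n then mu1 / z * max 0 (u (n - 1)) else 0) := by
    split_ifs
    · exact mul_nonneg (by positivity) (a1 _)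
    · exact le_rfl
  rcases le_total (u n) 0 with h | h
  · simp only [max_eq_left h, mul_zero, add_zero]
    linarith
  · simp only [max_eq_right h]
    linarith [husub n]

/-- At η the quadratic has the double root s/lam, so the interior balance is an equality. Phase 0
needs s ≤ lam + mu2 (1 - η), equivalently mu1 ≤ s, equivalently η ≤ lam/mu1; this is where mu1 ≤ mu2
enters, through the sign of tau at lam/mu1. -/
lemma tandemInf_tendsto_log_eta (hlam : 0 < lam) (h1 : lam < mu1) (h12 : mu1 ≤ mu2) {η : ℝ}
    (hη : 0 < η) (hη1 : η < 1) (hτ : tau lam mu1 mu2 η = 0) (i j : ℕ) :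
    Tendsto (fun K : ℕ => Real.log ((tandemInf lam mu1 mu2).hitProb 1 K i j) / (K : ℝ))
      atTop (𝓝 (Real.log η)) := by
  have hmu1 : 0 < mu1 := hlam.trans h1
  have hmu2 : 0 < mu2 := hmu1.trans_le h12
  have hηρ : η ≤ lam / mu1 := by
    by_contra hcon
    refine absurd (tau_neg_of_le hlam hmu1 hmu2 h1 (by positivity) (not_le.1 hcon) hη1 ?_) hτ.ge.not_gt
    rw [tau_div_mu1 hlam hmu1]
    exact mul_nonpos_of_nonpos_of_nonneg (by linarith)
      (sub_nonneg.2 ((div_le_one hmu1).2 h1.le))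
  set s := √(lam * mu1 / η) with hs
  have hs0 : 0 < s := Real.sqrt_pos.2 (by positivity)
  have hs2 : s ^ 2 = lam * mu1 / η := Real.sq_sqrt (by positivity)
  have hsD : 2 * s = lam + mu1 + mu2 * (1 - η) := by
    simp only [tau, ← hs] at hτ; linarith
  have hs1 : mu1 ≤ s := by
    refine Real.le_sqrt_of_sq_le ?_
    rw [le_div_iff₀ hη]
    rw [le_div_iff₀ hmu1] at hηρ
    nlinarith
  have hx : 0 < s / lam := by positivity
  have hlx : lam * (s / lam) = s := by field_simp
  have hmz : mu1 / η = s * (s / lam) := by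
    rw [mul_div_assoc', ← sq, hs2]; field_simp
  refine tendsto_log_div_of_bounds hη (C := η⁻¹ * (s / lam) ^ i / (s / lam) ^ j) (by positivity)
    (Eventually.of_forall fun K => tandemInf_hitProb_le hlam hmu1 hmu2 hη hx ?_ ?_ K i j) ?_
  · rw [hlx]; linarith
  · rw [hmz]
    refine le_of_eq ?_
    have : lam * (s / lam) ^ 2 = s * (s / lam) := by rw [sq, ← mul_assoc, hlx]
    rw [this]
    linear_combination (s / lam) * hsD
  · intro z hz hzη
    have hτz : 0 < tau lam mu1 mu2 z := by
      by_contra hcon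
      exact absurd (tau_neg_of_le hlam hmu1 hmu2 h1 hz hzη hη1 (not_lt.1 hcon)) hτ.ge.not_gt
    obtain ⟨v, M, n₀, hv, hM, hn₀, hsub⟩ :=
      exists_window_subsolution_of_tau_pos hlam hmu1 hz hτz
    exact tandemInf_le_hitProb hlam hmu1 hmu2 hz (hzη.trans hη1) hv hM hn₀ hsub i j

lemma tandemInf_tendsto_log_rho2 (hlam : 0 < lam) (h2 : lam < mu2) (h21 : mu2 < mu1) (i j : ℕ) :
    Tendsto (fun K : ℕ => Real.log ((tandemInf lam mu1 mu2).hitProb 1 K i j) / (K : ℝ))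
      atTop (𝓝 (Real.log (lam / mu2))) := by
  have hmu2 : 0 < mu2 := hlam.trans h2
  have hmu1 : 0 < mu1 := hmu2.trans h21
  refine tendsto_log_div_of_bounds (by positivity)
    -- The weight (mu2/lam)^{k+n} depends only on the total number of customers and satisfies both
    -- balance conditions with equality.
    (C := (lam / mu2)⁻¹ * (mu2 / lam) ^ i / (mu2 / lam) ^ j) (by positivity)
    (Eventually.of_forall fun K => tandemInf_hitProb_le hlam hmu1 hmu2 (by positivity)
      (by positivity) ?_ ?_ K i j) ?_
  · refine le_of_eq ?_; field_simp; ring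
  · refine le_of_eq ?_; field_simp; ring
  · intro s hs hsρ
    obtain ⟨z, hsz, hz, hz1, v, M, n₀, hv, hM, hn₀, hsub⟩ :=
      exists_window_subsolution_of_lt hlam hmu2 h2 h21 hsρ
    obtain ⟨c, hc, hev⟩ := tandemInf_le_hitProb hlam hmu1 hmu2 hz hz1 hv hM hn₀ hsub i j
    refine ⟨c, hc, hev.mono fun K hK => le_trans ?_ hK⟩
    gcongr

end DecayInfinite

/-! ### The stationary distribution and its uniqueness -/

section Stationary

variable {lam mu1 mu2 : ℝ}

/-- The flow of the measure `s` into the state `y`. -/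
def inflow (lam mu1 mu2 : ℝ) (s : ℕ × ℕ → ℝ) (y : ℕ × ℕ) : ℝ :=
  (if 0 < y.2 then lam * s (y.1, y.2 - 1) else 0) +
    (if 0 < y.1 then mu1 * s (y.1 - 1, y.2 + 1) else 0) + mu2 * s (y.1 + 1, y.2)

/-- The flow of the measure `s` out of the state `y`. -/
def outflow (lam mu1 mu2 : ℝ) (s : ℕ × ℕ → ℝ) (y : ℕ × ℕ) : ℝ :=
  lam * s y + (if 0 < y.2 then mu1 * s y else 0) + (if 0 < y.1 then mu2 * s y else 0)

lemma tandemInf_generator_apply (x y : ℕ × ℕ) : (tandemInf lam mu1 mu2).generator x y =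
    (if x = (y.1, y.2 - 1) then (if 0 < y.2 then lam else 0) else 0) +
    (if x = (y.1 - 1, y.2 + 1) then (if 0 < y.1 then mu1 else 0) else 0) +
    (if x = (y.1 + 1, y.2) then mu2 else 0) -
    (if x = y then lam + (if 0 < y.2 then mu1 else 0) + (if 0 < y.1 then mu2 else 0) else 0) := by
  obtain ⟨a, b⟩ := x
  obtain ⟨k, n⟩ := y
  have htop : (b : ℕ∞) < ⊤ := ENat.natCast_lt_top b
  simp only [QBD.generator, tandemInf, tandem, Prod.mk.injEq, htop, if_true]
  rcases Nat.lt_trichotomy k a with h | rfl | h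
  · rw [if_neg (by omega), if_neg (by omega), if_neg (c := a = k ∧ b = n - 1) (by omega),
      if_neg (c := a = k - 1 ∧ b = n + 1) (by omega), if_neg (c := a = k ∧ b = n) (by omega)]
    by_cases h1 : k + 1 = a
    · by_cases h2 : n = b
      · rw [if_pos h1, if_pos h2, if_pos ⟨h1.symm, h2.symm⟩]; ring
      · rw [if_pos h1, if_neg h2, if_neg (by omega)]; ring
    · rw [if_neg h1, if_neg (by omega)]; ring
  · rw [if_neg (by omega), if_pos rfl, if_neg (c := k = k + 1 ∧ b = n) (by omega)]
    have e2 : (if k = k - 1 ∧ b = n + 1 then (if 0 < k then mu1 else 0) else 0) = 0 := by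
      split_ifs
      · omega
      · rfl
      · rfl
    rw [e2]
    rcases Nat.lt_trichotomy b n with h | rfl | h
    · by_cases h1 : n = b + 1
      · rw [if_neg (c := k = k ∧ b = n) (by omega), if_pos (c := k = k ∧ b = n - 1) (by omega),
          if_pos (c := 0 < n) (by omega)]
        simp only [h1, if_true, ite_self]; ring
      · rw [if_neg (c := k = k ∧ b = n) (by omega), if_neg (c := k = k ∧ b = n - 1) (by omega)]
        rw [if_neg h1, if_neg h1, if_neg (c := n = b) (by omega), if_neg (c := n = b) (by omega)]
        simp
    · rw [if_pos (c := k = k ∧ b = b) (by simp), if_neg (c := b = b + 1) (by omega),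
        if_neg (c := b = b + 1) (by omega)]
      have e3 : (if k = k ∧ b = b - 1 then (if 0 < b then lam else 0) else 0) = 0 := by
        split_ifs
        · omega
        · rfl
        · rfl
      rw [e3]
      simp only [if_true]
      rcases Nat.eq_zero_or_pos k with hk | hk
      · simp only [hk, if_true, lt_irrefl, if_false]; ring
      · simp only [hk, hk.ne', if_true, if_false]; ring
    · rw [if_neg (c := k = k ∧ b = n) (by omega), if_neg (c := k = k ∧ b = n - 1) (by omega),
        if_neg (c := n = b + 1) (by omega), if_neg (c := n = b) (by omega),
        if_neg (c := n = b + 1) (by omega), if_neg (c := n = b) (by omega)]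
      simp
  · rw [if_neg (c := k = a) (by omega), if_neg (c := k + 1 = a) (by omega),
      if_neg (c := a = k ∧ b = n - 1) (by omega), if_neg (c := a = k + 1 ∧ b = n) (by omega),
      if_neg (c := a = k ∧ b = n) (by omega)]
    by_cases h1 : k = a + 1
    · by_cases h2 : n + 1 = b
      · rw [if_pos h1, if_pos h2, if_pos (by omega), if_pos (by omega)]; ring
      · rw [if_pos h1, if_neg h2, if_neg (by omega)]; ring
    · rw [if_neg h1, if_neg (by omega)]; ring

lemma hasSum_mul_generator (s : ℕ × ℕ → ℝ) (y : ℕ × ℕ) :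
    HasSum (fun x => s x * (tandemInf lam mu1 mu2).generator x y)
      (inflow lam mu1 mu2 s y - outflow lam mu1 mu2 s y) := by
  have hone : ∀ (p : ℕ × ℕ) (c : ℝ), HasSum (fun x => s x * if x = p then c else 0) (s p * c) := by
    intro p c
    convert hasSum_single (f := fun x => s x * if x = p then c else 0) p ?_ using 1
    · simp
    · intro x hx; simp [hx]
  have h := (((hone (y.1, y.2 - 1) (if 0 < y.2 then lam else 0)).add
    (hone (y.1 - 1, y.2 + 1) (if 0 < y.1 then mu1 else 0))).add (hone (y.1 + 1, y.2) mu2)).sub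
    (hone y (lam + (if 0 < y.2 then mu1 else 0) + (if 0 < y.1 then mu2 else 0)))
  have e : inflow lam mu1 mu2 s y - outflow lam mu1 mu2 s y =
      s (y.1, y.2 - 1) * (if 0 < y.2 then lam else 0) +
      s (y.1 - 1, y.2 + 1) * (if 0 < y.1 then mu1 else 0) + s (y.1 + 1, y.2) * mu2 -
      s y * (lam + (if 0 < y.2 then mu1 else 0) + (if 0 < y.1 then mu2 else 0)) := by
    simp only [inflow, outflow]
    split_ifs <;> ring
  rw [e]
  have e' : (fun x => s x * (tandemInf lam mu1 mu2).generator x y) = _ := funext fun x => by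
    rw [tandemInf_generator_apply, mul_sub, mul_add, mul_add]
  rw [e']
  exact h

lemma isStationary_iff (π : ℕ × ℕ → ℝ) : IsStationary (tandemInf lam mu1 mu2).generator π ↔
    (∀ x, 0 ≤ π x) ∧ HasSum π 1 ∧ ∀ y, inflow lam mu1 mu2 π y = outflow lam mu1 mu2 π y := by
  refine and_congr_right fun _ => and_congr_right fun _ => forall_congr' fun y => ?_
  have h := hasSum_mul_generator (lam := lam) (mu1 := mu1) (mu2 := mu2) π y
  exact ⟨fun h' => sub_eq_zero.1 (h.unique h'), fun h' => by rwa [sub_eq_zero.2 h'] at h⟩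

/-- The product form of the stationary distribution. -/
def productForm (lam mu1 mu2 : ℝ) (x : ℕ × ℕ) : ℝ :=
  ((1 - lam / mu2) * (lam / mu2) ^ x.1) * ((1 - lam / mu1) * (lam / mu1) ^ x.2)

lemma hasSum_geometric_pmf {r : ℝ} (h0 : 0 ≤ r) (h1 : r < 1) :
    HasSum (fun n : ℕ => (1 - r) * r ^ n) 1 := by
  have := (hasSum_geometric_of_lt_one h0 h1).mul_left (1 - r)
  rwa [mul_inv_cancel₀ (by linarith)] at this

lemma isStationary_productForm (hlam : 0 < lam) (h1 : lam < mu1) (h2 : lam < mu2) :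
    IsStationary (tandemInf lam mu1 mu2).generator (productForm lam mu1 mu2) := by
  have hmu1 : 0 < mu1 := hlam.trans h1
  have hmu2 : 0 < mu2 := hlam.trans h2
  have hρ1 : lam / mu1 < 1 := (div_lt_one hmu1).2 h1
  have hρ2 : lam / mu2 < 1 := (div_lt_one hmu2).2 h2
  have p1 : 0 ≤ 1 - lam / mu1 := by linarith
  have p2 : 0 ≤ 1 - lam / mu2 := by linarith
  rw [isStationary_iff]
  refine ⟨fun x => by unfold productForm; positivity, ?_, ?_⟩
  · have a1 := hasSum_geometric_pmf (r := lam / mu1) (by positivity) hρ1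
    have a2 := hasSum_geometric_pmf (r := lam / mu2) (by positivity) hρ2
    have := a2.mul a1 (a2.summable.mul_of_nonneg a1.summable (fun n => by positivity)
      (fun n => by positivity))
    rwa [mul_one] at this
  · rintro ⟨k, n⟩
    rcases k with _ | k <;> rcases n with _ | n <;>
    · simp only [inflow, outflow, productForm, lt_irrefl, if_false, Nat.succ_pos, if_true,
        Nat.add_sub_cancel, pow_succ, pow_zero, zero_add]
      field_simp
      try ring

/-- A zero of a nonnegative invariant measure forces zeros at all states that jump into it, and the
chain is irreducible. The route goes up in level, along transfers backwards to level 0, up again,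
then back along arrivals. -/
lemma eq_zero_of_balance (hlam : 0 < lam) (hmu1 : 0 < mu1) (hmu2 : 0 < mu2) {p : ℕ × ℕ → ℝ}
    (hp : ∀ x, 0 ≤ p x) (hbal : ∀ y, inflow lam mu1 mu2 p y = outflow lam mu1 mu2 p y)
    {y : ℕ × ℕ} (hy : p y = 0) : p = 0 := by
  have hnb : ∀ k n, p (k, n) = 0 → (0 < n → p (k, n - 1) = 0) ∧ (0 < k → p (k - 1, n + 1) = 0) ∧
      p (k + 1, n) = 0 := by
    intro k n h
    have hb := hbal (k, n)
    simp only [outflow, h, mul_zero, ite_self, add_zero, inflow] at hb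
    have q1 : 0 ≤ (if 0 < n then lam * p (k, n - 1) else 0) := by
      split_ifs
      · exact mul_nonneg hlam.le (hp _)
      · exact le_rfl
    have q2 : 0 ≤ (if 0 < k then mu1 * p (k - 1, n + 1) else 0) := by
      split_ifs
      · exact mul_nonneg hmu1.le (hp _)
      · exact le_rfl
    have q3 : 0 ≤ mu2 * p (k + 1, n) := mul_nonneg hmu2.le (hp _)
    refine ⟨fun hn => ?_, fun hk => ?_, ?_⟩
    · rw [if_pos hn] at hb q1
      exact (mul_eq_zero.1 (by linarith : lam * p (k, n - 1) = 0)).resolve_left hlam.ne'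
    · rw [if_pos hk] at hb q2
      exact (mul_eq_zero.1 (by linarith : mu1 * p (k - 1, n + 1) = 0)).resolve_left hmu1.ne'
    · exact (mul_eq_zero.1 (by linarith : mu2 * p (k + 1, n) = 0)).resolve_left hmu2.ne'
  have hup : ∀ d k n, p (k, n) = 0 → p (k + d, n) = 0 := by
    intro d
    induction d with
    | zero => exact fun k n h => h
    | succ d ih => exact fun k n h => (hnb _ _ (ih k n h)).2.2
  have hdown : ∀ k n, p (k, n) = 0 → p (0, n + k) = 0 := by
    intro k
    induction k with
    | zero => exact fun n h => h
    | succ k ih =>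
      intro n h
      have := ih (n + 1) ((hnb (k + 1) n h).2.1 (Nat.succ_pos k))
      rwa [show n + 1 + k = n + (k + 1) by omega] at this
  have hleft : ∀ d k n, p (k, n + d) = 0 → p (k, n) = 0 := by
    intro d
    induction d with
    | zero => exact fun k n h => h
    | succ d ih =>
      intro k n h
      have := (hnb k (n + (d + 1)) h).1 (by omega)
      exact ih k n (by rwa [show n + (d + 1) - 1 = n + d by omega] at this)
  funext ⟨k, n⟩
  obtain ⟨k₀, n₀⟩ := y
  have a1 := hdown _ _ (hup n _ _ hy)
  have a2 := hup k _ _ a1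
  rw [zero_add, show n₀ + (k₀ + n) = n + (n₀ + k₀) by omega] at a2
  exact hleft _ _ _ a2

/-- For a summable measure, the flow of each transition is counted once at its target and once at
its source; reindexing by shifts makes the totals equal. -/
lemma hasSum_inflow_sub_outflow (hmu1 : 0 < mu1) (hmu2 : 0 < mu2)
    {t : ℕ × ℕ → ℝ} (ht : ∀ x, 0 ≤ t x) (hs : Summable t) :
    HasSum (fun y => inflow lam mu1 mu2 t y - outflow lam mu1 mu2 t y) 0 := by
  have inj1 : Function.Injective (fun y : ℕ × ℕ => (y.1, y.2 + 1)) := by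
    rintro ⟨a, b⟩ ⟨c, d⟩ h; simpa using h
  have inj2 : Function.Injective (fun y : ℕ × ℕ => (y.1 + 1, y.2)) := by
    rintro ⟨a, b⟩ ⟨c, d⟩ h; simpa using h
  have hr1 : ∀ y : ℕ × ℕ, y ∉ Set.range (fun y : ℕ × ℕ => (y.1, y.2 + 1)) → ¬ 0 < y.2 := by
    rintro ⟨a, b⟩ h hb
    exact h ⟨(a, b - 1), Prod.ext rfl (Nat.sub_add_cancel hb)⟩
  have hr2 : ∀ y : ℕ × ℕ, y ∉ Set.range (fun y : ℕ × ℕ => (y.1 + 1, y.2)) → ¬ 0 < y.1 := by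
    rintro ⟨a, b⟩ h hb
    exact h ⟨(a - 1, b), Prod.ext (Nat.sub_add_cancel hb) rfl⟩
  have sA : Summable fun y : ℕ × ℕ => if 0 < y.2 then mu1 * t y else 0 :=
    Summable.of_nonneg_of_le (fun y => by have := ht y; positivity)
      (fun y => by
        split_ifs
        · exact le_rfl
        · exact mul_nonneg hmu1.le (ht y)) (hs.mul_left mu1)
  have sB : Summable fun y : ℕ × ℕ => if 0 < y.1 then mu2 * t y else 0 :=
    Summable.of_nonneg_of_le (fun y => by have := ht y; positivity)
      (fun y => by
        split_ifs
        · exact le_rfl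
        · exact mul_nonneg hmu2.le (ht y)) (hs.mul_left mu2)
  have i1 : HasSum (fun y : ℕ × ℕ => if 0 < y.2 then lam * t (y.1, y.2 - 1) else 0)
      (lam * ∑' y, t y) := by
    rw [← inj1.hasSum_iff fun y hy => if_neg (hr1 y hy)]
    simpa [Function.comp_def] using hs.hasSum.mul_left lam
  have i2 : HasSum (fun y : ℕ × ℕ => if 0 < y.1 then mu1 * t (y.1 - 1, y.2 + 1) else 0)
      (∑' y : ℕ × ℕ, if 0 < y.2 then mu1 * t y else 0) := by
    rw [← inj2.hasSum_iff fun y hy => if_neg (hr2 y hy)]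
    have := (inj1.hasSum_iff fun y hy => if_neg (hr1 y hy)).2 sA.hasSum
    simpa [Function.comp_def] using this
  have i3 : HasSum (fun y : ℕ × ℕ => mu2 * t (y.1 + 1, y.2))
      (∑' y : ℕ × ℕ, if 0 < y.1 then mu2 * t y else 0) := by
    have := (inj2.hasSum_iff fun y hy => if_neg (hr2 y hy)).2 sB.hasSum
    simpa [Function.comp_def] using this
  have hin := (i1.add i2).add i3
  have hout := ((hs.hasSum.mul_left lam).add sA.hasSum).add sB.hasSum
  have h := hin.sub hout
  rw [sub_self] at h
  exact h

/-- Outflow is a nonnegative multiple of the mass at the state, so it commutes with absolute values;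
inflow is a sum, to which the triangle inequality applies. -/
lemma abs_outflow_le (hlam : 0 < lam) (hmu1 : 0 < mu1) (hmu2 : 0 < mu2) {σ : ℕ × ℕ → ℝ}
    (hbal : ∀ y, inflow lam mu1 mu2 σ y = outflow lam mu1 mu2 σ y) (y : ℕ × ℕ) :
    outflow lam mu1 mu2 (fun x => |σ x|) y ≤ inflow lam mu1 mu2 (fun x => |σ x|) y := by
  have e : outflow lam mu1 mu2 (fun x => |σ x|) y = |outflow lam mu1 mu2 σ y| := by
    have : outflow lam mu1 mu2 σ y
        = (lam + (if 0 < y.2 then mu1 else 0) + (if 0 < y.1 then mu2 else 0)) * σ y := by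
      unfold outflow; split_ifs <;> ring
    rw [this, abs_mul, abs_of_nonneg (by positivity)]
    unfold outflow; split_ifs <;> ring
  rw [e, ← hbal, inflow, inflow]
  refine (abs_add_three _ _ _).trans (le_of_eq ?_)
  congr 1
  · congr 1
    · split_ifs
      · rw [abs_mul, abs_of_pos hlam]
      · simp
    · split_ifs
      · rw [abs_mul, abs_of_pos hmu1]
      · simp
  · rw [abs_mul, abs_of_pos hmu2]

lemma IsStationary.unique (hlam : 0 < lam) (hmu1 : 0 < mu1) (hmu2 : 0 < mu2) {π π' : ℕ × ℕ → ℝ}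
    (h : IsStationary (tandemInf lam mu1 mu2).generator π)
    (h' : IsStationary (tandemInf lam mu1 mu2).generator π') : π = π' := by
  rw [isStationary_iff] at h h'
  set σ : ℕ × ℕ → ℝ := fun x => π x - π' x with hσ
  have hsum : HasSum σ 0 := by simpa using h.2.1.sub h'.2.1
  have hbal : ∀ y, inflow lam mu1 mu2 σ y = outflow lam mu1 mu2 σ y := by
    intro y
    have a := h.2.2 y
    have b := h'.2.2 y
    unfold inflow outflow at a b ⊢
    simp only [hσ]
    split_ifs at a b ⊢ <;> linarith
  set t : ℕ × ℕ → ℝ := fun x => |σ x| with ht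
  -- The inequalities between outflow and inflow of |σ| have total defect zero, so each is an
  -- equality and |σ| is invariant too.
  have htbal : ∀ y, inflow lam mu1 mu2 t y = outflow lam mu1 mu2 t y := by
    have hz := (hasSum_zero_iff_of_nonneg fun y =>
      sub_nonneg.2 (abs_outflow_le hlam hmu1 hmu2 hbal y)).1
      (hasSum_inflow_sub_outflow hmu1 hmu2 (fun x => abs_nonneg _) hsum.summable.abs)
    exact fun y => sub_eq_zero.1 (congrFun hz y)
  have hcomb : ∀ c : ℝ, ∀ y, inflow lam mu1 mu2 (fun x => t x + c * σ x) y
      = outflow lam mu1 mu2 (fun x => t x + c * σ x) y := by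
    intro c y
    have a := htbal y
    have b := congrArg (fun u => c * u) (hbal y)
    unfold inflow outflow at a b ⊢
    simp only at b ⊢
    split_ifs at a b ⊢ <;> linarith
  -- One of |σ| - σ and |σ| + σ vanishes at (0, 0), hence everywhere; then σ has constant sign, and
  -- its total mass 0 makes it zero.
  have hσ0 : σ = 0 := by
    rcases le_total 0 (σ (0, 0)) with h0 | h0
    · have hz := eq_zero_of_balance hlam hmu1 hmu2 (p := fun x => t x + (-1) * σ x)
        (fun x => by simp only [ht]; linarith [le_abs_self (σ x)]) (hcomb (-1))
        (y := (0, 0)) (by simp only [ht, abs_of_nonneg h0]; ring)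
      refine (hasSum_zero_iff_of_nonneg fun x => ?_).1 hsum
      have := congrFun hz x
      simp only [ht, Pi.zero_apply] at this ⊢
      linarith [abs_nonneg (σ x)]
    · have hz := eq_zero_of_balance hlam hmu1 hmu2 (p := fun x => t x + 1 * σ x)
        (fun x => by simp only [ht]; linarith [neg_abs_le (σ x)]) (hcomb 1)
        (y := (0, 0)) (by simp only [ht, abs_of_nonpos h0]; ring)
      have hneg := (hasSum_zero_iff_of_nonneg (f := fun x => -σ x) fun x => by
        have := congrFun hz x
        simp only [ht, Pi.zero_apply] at this ⊢
        linarith [abs_nonneg (σ x)]).1 (by simpa using hsum.neg)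
      funext x
      have := congrFun hneg x
      simpa using this
  funext x
  exact sub_eq_zero.1 (congrFun hσ0 x)

lemma tendsto_log_productForm (hlam : 0 < lam) (h1 : lam < mu1) (h2 : lam < mu2) :
    Tendsto (fun K : ℕ => Real.log (∑' j : ℕ, productForm lam mu1 mu2 (K, j)) / (K : ℝ))
      atTop (𝓝 (Real.log (lam / mu2))) := by
  have hmu1 : 0 < mu1 := hlam.trans h1
  have hmu2 : 0 < mu2 := hlam.trans h2
  have hρ2 : lam / mu2 < 1 := (div_lt_one hmu2).2 h2
  have hval : ∀ K : ℕ, ∑' j : ℕ, productForm lam mu1 mu2 (K, j)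
      = (1 - lam / mu2) * (lam / mu2) ^ K := by
    intro K
    have := ((hasSum_geometric_pmf (r := lam / mu1) (by positivity)
      ((div_lt_one hmu1).2 h1)).mul_left ((1 - lam / mu2) * (lam / mu2) ^ K)).tsum_eq
    rwa [mul_one] at this
  simp only [hval]
  have hC : 0 < 1 - lam / mu2 := by linarith
  refine tendsto_log_div_of_bounds (by positivity) hC (Eventually.of_forall fun K => le_rfl)
    fun s hs hsr => ⟨1 - lam / mu2, hC, Eventually.of_forall fun K => ?_⟩
  gcongr

end Stationary

end Tandem

end

open Tandem
theorem theorem8p2 (lam mu1 mu2 : ℝ) (hlam : 0 < lam) (hmu1 : 0 < mu1) (hmu2 : 0 < mu2) :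
    -- finite capacity `m` of the first queue
    (∀ m : ℕ, 1 ≤ m → FiniteStable lam mu1 mu2 m →
      ∃ h : ℝ, IsMaximalEigenvalue (tandemFin lam mu1 mu2 m).H h ∧ 0 < h ∧ h < 1 ∧
        ∀ i j : Fin (m + 1), (j : ℕ) < m →
          Tendsto (fun K : ℕ => Real.log ((tandemFin lam mu1 mu2 m).hitProb 1 K i j) / (K : ℝ))
            atTop (𝓝 (Real.log h))) ∧
    -- unlimited capacity of the first queue
    (lam < min mu1 mu2 →
      ∃ η : ℝ, (0 < η ∧ η < 1 ∧ tau lam mu1 mu2 η = 0) ∧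
        (∀ z : ℝ, 0 < z → z < 1 → tau lam mu1 mu2 z = 0 → z = η) ∧
        (mu1 ≤ mu2 → ∀ i j : ℕ,
          Tendsto (fun K : ℕ => Real.log ((tandemInf lam mu1 mu2).hitProb 1 K i j) / (K : ℝ))
            atTop (𝓝 (Real.log η))) ∧
        (mu2 < mu1 → ∀ i j : ℕ,
          Tendsto (fun K : ℕ => Real.log ((tandemInf lam mu1 mu2).hitProb 1 K i j) / (K : ℝ))
            atTop (𝓝 (Real.log (lam / mu2)))) ∧
        -- the stationary decay rate of the second queue, and the comparison
        (∃! π : ℕ × ℕ → ℝ, IsStationary (tandemInf lam mu1 mu2).generator π) ∧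
        (∀ π : ℕ × ℕ → ℝ, IsStationary (tandemInf lam mu1 mu2).generator π →
          Tendsto (fun K : ℕ => Real.log (∑' j : ℕ, π (K, j)) / (K : ℝ))
            atTop (𝓝 (Real.log (lam / mu2)))) ∧
        (mu1 < mu2 → η ≠ lam / mu2)) := by
  refine ⟨fun m hm hst => tandemFin_exists_decayRate hlam hmu1 hmu2 hm hst, fun h => ?_⟩
  have h1 : lam < mu1 := h.trans_le (min_le_left _ _)
  have h2 : lam < mu2 := h.trans_le (min_le_right _ _)
  have hst := isStationary_productForm hlam h1 h2
  obtain ⟨η, hη, hη1, hτ⟩ := exists_tau_eq_zero (mu2 := mu2) hlam hmu1 h1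
  refine ⟨η, ⟨hη, hη1, hτ⟩, fun z hz hz1 hτz => ?_,
    fun h12 i j => tandemInf_tendsto_log_eta hlam h1 h12 hη hη1 hτ i j,
    fun h21 i j => tandemInf_tendsto_log_rho2 hlam h2 h21 i j,
    ⟨_, hst, fun π hπ => hπ.unique hlam hmu1 hmu2 hst⟩, fun π hπ => ?_, fun h12 hcon => ?_⟩
  · rcases lt_trichotomy z η with hlt | heq | hlt
    · exact absurd hτ (tau_neg_of_le hlam hmu1 hmu2 h1 hz hlt hη1 hτz.le).ne
    · exact heq
    · exact absurd hτz (tau_neg_of_le hlam hmu1 hmu2 h1 hη hlt hz1 hτ.le).ne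
  · rw [hπ.unique hlam hmu1 hmu2 hst]
    exact tendsto_log_productForm hlam h1 h2
  -- Equality of the two rates would give equality in the arithmetic–geometric mean inequality for
  -- mu1 < mu2.
  · rw [hcon, tau_div_mu2 hlam hmu2] at hτ
    linarith [two_mul_sqrt_lt hmu1 hmu2 h12]
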